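/- Let $d\ge 1$ and let $\Omega\subset\mathbb R^d$ be a bounded domain, i.e. open, bounded and connected. Say that $\Omega$ has a $C^1$ (respectively Lipschitz) boundary if every $z\in\partial\Omega$ has a neighbourhood $U$ in which, in suitable orthonormal coordinates $(x',x_d)\in\mathbb R^{d-1}\times\mathbb R$, $\Omega\cap U=\{x\in U: x_d<\gamma(x')\}$ for a $C^1$ (respectively Lipschitz) function $\gamma:\mathbb R^{d-1}\to\mathbb R$. A unit vector $\vec n(z)$ is the outward unit normal vector at $z$ if for every $\epsilon>0$ the points $x$ close to $z$ with $(x-z)\cdot\vec n(z)>\epsilon|x-z|$ are outside $\Omega$ and those with $(x-z)\cdot\vec n(z)<-\epsilon|x-z|$ are in $\Omega$ (in the above coordinates: $\gamma$ is differentiable at $z'$ and $\vec n(z)=(-\nabla\gamma(z'),1)/\sqrt{1+|\nabla\gamma(z')|^2}$). Let $\sigma_{d-1}$ be the surface measure, i.e. the $(d-1)$-dimensional Hausdorff measure $\mathcal H^{d-1}$ on $\partial\Omega$, normalized so that $\mathcal H^{k}$ is Lebesgue measure on $\mathbb R^k$. Write $F\in C^1(\overline\Omega;\mathbb R^d)$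 if $F$ is continuous on $\overline\Omega$ and differentiable in $\Omega$, with a derivative that extends continuously to $\overline\Omega$. (i) If $\Omega$ has a $C^1$ boundary, then the outward unit normal vector $\vec n(z)$ exists at every $z\in\partial\Omega$, and for every $F\in C^1(\overline\Omega;\mathbb R^d)$ both integrands below are integrable and $$\int_\Omega \operatorname{div}F(x)\,dx=\int_{\partial\Omega}F(x)\cdot\vec n(x)\,d\sigma_{d-1}(x).\tag{DT}$$ (ii) For every $F\in C^1(\overline\Omega;\mathbb R^d)$, both integrands are integrable and (DT) holds also if $\Omega$ has a piecewise $C^1$ boundary that is accessible from the exterior, in the following sense. *Piecewise $C^1$:* $\partial\Omega$ is Lipschitz and is the disjoint union of sets $G_1,\dots,G_N,B$ such that $\mathcal H^{d-1}(B)=0$, each $G_i$ is connected, and $\vec n$ exists and is uniformly continuous on each $G_i$. *Accessible from the exterior:* for $M\subset\partial\Omega$ and $\varepsilon>0$ put $M^\varepsilon=\{x\in\Omega^c: x=z+t\,\vec n(z)\text{ for some }z\in M,\ t\in(0,\varepsilon)\}$ and $\Omega^c_\varepsilon=\{x\in\Omega^c:\operatorname{dist}(x,\partial\Omega)<\varepsilon\}$.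 There are sets $G_{i,\delta}\subset G_i$ ($1\le i\le N$, $\delta>0$) with $G_{i,\delta}\subset G_{i,\eta}$ for $0<\eta\le\delta$ and $\bigcup_{\delta>0}G_{i,\delta}=G_i$, such that for every $\delta>0$ there is $\varepsilon_0>0$ with $G_{i,\delta}^\varepsilon\cap G_{j,\delta}^\varepsilon=\emptyset$ for all $i\ne j$ and $\varepsilon\in(0,\varepsilon_0)$, and such that $\lim_{\delta\to0}\lim_{\varepsilon\to0}\varepsilon^{-1}\big|\Omega^c_\varepsilon\setminus\bigcup_{i=1}^N G_{i,\delta}^\varepsilon\big|=0$, where $|\cdot|$ is Lebesgue (outer) measure and the inner limits are assumed to exist. -/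

import Mathlib

open Set Filter Topology MeasureTheory

noncomputable section

/-- `ℝ^d` with its Euclidean norm. -/
abbrev Euc (d : ℕ) : Type := EuclideanSpace ℝ (Fin d)

/-- A bounded domain: an open, bounded, connected subset of `ℝ^d`. -/
structure IsBoundedDomain {d : ℕ} (Ω : Set (Euc d)) : Prop where
  isOpen : IsOpen Ω
  isBounded : Bornology.IsBounded Ω
  isConnected : IsConnected Ω

/-- Near each of its boundary points `Ω` is, in suitable orthonormal coordinates
`φ x = (x', x_d) ∈ ℝ^{d-1} × ℝ`, the region `{x_d < γ(x')}` strictly below the graph of a function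
`γ : ℝ^{d-1} → ℝ` with property `P` (translations are absorbed in `γ`). For continuous `γ` the
boundary of `Ω` inside the neighbourhood `U` is then the graph of `γ`, once `U` is open. -/
def HasGraphBoundary {d : ℕ} (P : (Euc (d - 1) → ℝ) → Prop) (Ω : Set (Euc d)) : Prop :=
  ∀ z ∈ frontier Ω, ∃ U ∈ 𝓝 z, ∃ φ : Euc d ≃ₗᵢ[ℝ] WithLp 2 (Euc (d - 1) × ℝ),
    ∃ γ : Euc (d - 1) → ℝ, P γ ∧ ∀ x ∈ U, x ∈ Ω ↔ (φ x).snd < γ (φ x).fst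

/-- The boundary of `Ω` is `C¹`. -/
def HasC1Boundary {d : ℕ} (Ω : Set (Euc d)) : Prop :=
  HasGraphBoundary (fun γ => ContDiff ℝ 1 γ) Ω

/-- The boundary of `Ω` is Lipschitz. -/
def HasLipschitzBoundary {d : ℕ} (Ω : Set (Euc d)) : Prop :=
  HasGraphBoundary (fun γ => ∃ K : NNReal, LipschitzWith K γ) Ω

/-- `ν` is an outward unit normal vector to `∂Ω` at `z`: for every aperture `ε > 0`, close to `z`
the cone `{⟨x - z, ν⟩ > ε |x - z|}` lies outside `Ω` and the opposite cone lies in `Ω`. If `Ω` is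
near `z` the region below the graph of a Lipschitz function `γ`, such a `ν` exists if and only if
`γ` is differentiable at the corresponding point `z'`, and then `ν` is the vector with coordinates
`(-∇γ(z'), 1) / √(1 + |∇γ(z')|²)`. -/
def IsOutwardUnitNormal {d : ℕ} (Ω : Set (Euc d)) (z ν : Euc d) : Prop :=
  ‖ν‖ = 1 ∧ ∀ ε : ℝ, 0 < ε → ∀ᶠ x in 𝓝 z,
    (ε * ‖x - z‖ < inner ℝ (x - z) ν → x ∉ Ω) ∧
    (inner ℝ (x - z) ν < -(ε * ‖x - z‖) → x ∈ Ω)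

/-- An outward unit normal vector at a point is unique. -/
theorem IsOutwardUnitNormal.unique {d : ℕ} {Ω : Set (Euc d)} {z ν ν' : Euc d}
    (h : IsOutwardUnitNormal Ω z ν) (h' : IsOutwardUnitNormal Ω z ν') : ν = ν' := by
  by_contra hne
  have hv : 0 < ‖ν - ν'‖ := norm_pos_iff.mpr (sub_ne_zero.mpr hne)
  have hsq : ‖ν - ν'‖ ^ 2 = 2 - 2 * inner ℝ ν ν' := by
    rw [norm_sub_sq_real, h.1, h'.1]; ring
  have h1 : inner ℝ (ν - ν') ν = ‖ν - ν'‖ ^ 2 / 2 := by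
    rw [inner_sub_left, real_inner_self_eq_norm_sq, h.1, real_inner_comm, hsq]; ring
  have h2 : inner ℝ (ν - ν') ν' = -(‖ν - ν'‖ ^ 2 / 2) := by
    rw [inner_sub_left, real_inner_self_eq_norm_sq, h'.1, hsq]; ring
  have hε : 0 < ‖ν - ν'‖ / 4 := by positivity
  have hlim : Tendsto (fun t : ℝ => z + t • (ν - ν')) (𝓝[>] 0) (𝓝 z) := by
    have : Continuous (fun t : ℝ => z + t • (ν - ν')) := by fun_prop
    simpa using (this.tendsto 0).mono_left nhdsWithin_le_nhds
  obtain ⟨t, ⟨⟨hout, -⟩, -, hin⟩, ht⟩ :=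
    (((hlim.eventually (h.2 _ hε)).and (hlim.eventually (h'.2 _ hε))).and
      self_mem_nhdsWithin).exists
  have ht' : (0 : ℝ) < t := ht
  have hp : 0 < t * ‖ν - ν'‖ ^ 2 := by positivity
  simp only [add_sub_cancel_left, inner_smul_left, norm_smul, Real.norm_eq_abs,
    abs_of_pos ht', h1, h2, RCLike.conj_to_real] at hout hin
  exact hout (by nlinarith) (hin (by nlinarith))

open Classical in
/-- The outward unit normal vector to `∂Ω` at `z`, with the value `0` where it does not exist. -/
def outwardNormal {d : ℕ} (Ω : Set (Euc d)) (z : Euc d) : Euc d :=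
  if h : ∃ ν, IsOutwardUnitNormal Ω z ν then h.choose else 0

/-- `F ∈ C¹(Ω̄; ℝ^d)` for an open set `Ω`: `F` is continuous on `Ω̄` and differentiable in `Ω`, and
its derivative in `Ω` is the restriction of a continuous function on `Ω̄`. -/
def IsC1OnClosure {d : ℕ} (Ω : Set (Euc d)) (F : Euc d → Euc d) : Prop :=
  ContinuousOn F (closure Ω) ∧ ∃ G : Euc d → Euc d →L[ℝ] Euc d,
    ContinuousOn G (closure Ω) ∧ ∀ x ∈ Ω, HasFDerivAt F (G x) x

/-- The divergence `div F(x) = ∑ᵢ ∂ᵢFᵢ(x)`. -/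
def divergence {d : ℕ} (F : Euc d → Euc d) (x : Euc d) : ℝ :=
  ∑ i : Fin d, (fderiv ℝ F x (EuclideanSpace.single i 1)) i

/-- The surface measure on `∂Ω`: the `(d-1)`-dimensional Hausdorff measure (in the normalization
that makes `k`-dimensional Hausdorff measure on `ℝ^k` equal to Lebesgue measure), restricted to
`∂Ω`. -/
def surfaceMeasure {d : ℕ} (Ω : Set (Euc d)) : Measure (Euc d) :=
  (μHE[d - 1] : Measure (Euc d)).restrict (frontier Ω)

/-- `∂Ω = G₁ ∪ ⋯ ∪ G_N ∪ B` exhibits the set `Ω` as having a piecewise `C¹` boundary: the boundary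
is Lipschitz, the `N + 1` sets are disjoint, `B` is null for the `(d-1)`-dimensional measure, each
`Gᵢ` is connected, and the outward unit normal vector exists and is uniformly continuous on each
`Gᵢ`. -/
structure IsPiecewiseC1Boundary {d N : ℕ} (Ω : Set (Euc d)) (G : Fin N → Set (Euc d))
    (B : Set (Euc d)) : Prop where
  lipschitz : HasLipschitzBoundary Ω
  union_eq : frontier Ω = (⋃ i, G i) ∪ B
  disjoint_pieces : ∀ i j, i ≠ j → Disjoint (G i) (G j)
  disjoint_rest : ∀ i, Disjoint (G i) B
  null_rest : (μHE[d - 1] : Measure (Euc d)) B = 0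
  connected : ∀ i, IsConnected (G i)
  normal_exists : ∀ i, ∀ z ∈ G i, IsOutwardUnitNormal Ω z (outwardNormal Ω z)
  normal_unifCont : ∀ i, UniformContinuousOn (outwardNormal Ω) (G i)

/-- The exterior `ε`-neighbourhood `M^ε = {x ∈ Ωᶜ | x = z + t n(z), z ∈ M, 0 < t < ε}` of
`M ⊆ ∂Ω`. -/
def exteriorNhd {d : ℕ} (Ω M : Set (Euc d)) (ε : ℝ) : Set (Euc d) :=
  {x | x ∉ Ω ∧ ∃ z ∈ M, ∃ t ∈ Ioo 0 ε, x = z + t • outwardNormal Ω z}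

/-- The exterior collar `Ωᶜ_ε = {x ∈ Ωᶜ | dist(x, ∂Ω) < ε}`. -/
def exteriorCollar {d : ℕ} (Ω : Set (Euc d)) (ε : ℝ) : Set (Euc d) :=
  {x | x ∉ Ω ∧ Metric.infDist x (frontier Ω) < ε}

/-- The boundary pieces `Gᵢ` are accessible from the exterior: they are exhausted, as `δ → 0`, by
sets `G_{i,δ} = H i δ` whose exterior `ε`-neighbourhoods are disjoint for small `ε` and fill up the
exterior `ε`-collar except for a set `B(δ, ε)` with
`lim_{δ → 0} lim_{ε → 0} ε⁻¹ |B(δ, ε)| = 0`. -/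
def AccessibleFromExterior {d N : ℕ} (Ω : Set (Euc d)) (G : Fin N → Set (Euc d)) : Prop :=
  ∃ H : Fin N → ℝ → Set (Euc d),
    (∀ i, ∀ δ > 0, H i δ ⊆ G i) ∧
    (∀ i, ∀ δ > 0, ∀ η > 0, η ≤ δ → H i δ ⊆ H i η) ∧
    (∀ δ > 0, ∃ ε₀ > 0, ∀ i j, i ≠ j → ∀ ε ∈ Ioo 0 ε₀,
      Disjoint (exteriorNhd Ω (H i δ) ε) (exteriorNhd Ω (H j δ) ε)) ∧
    (∀ i, ⋃ δ > (0 : ℝ), H i δ = G i) ∧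
    ∃ L : ℝ → ENNReal,
      (∀ δ > 0, Tendsto
        (fun ε : ℝ => volume (exteriorCollar Ω ε \ ⋃ i, exteriorNhd Ω (H i δ) ε) / ENNReal.ofReal ε)
        (𝓝[>] 0) (𝓝 (L δ))) ∧
      Tendsto L (𝓝[>] 0) (𝓝 0)

/-- `Ω` has a piecewise `C¹` boundary that is accessible from the exterior. -/
def HasAccessiblePiecewiseC1Boundary {d : ℕ} (Ω : Set (Euc d)) : Prop :=
  ∃ (N : ℕ) (G : Fin N → Set (Euc d)) (B : Set (Euc d)),
    IsPiecewiseC1Boundary Ω G B ∧ AccessibleFromExterior Ω G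

end

/-! Both kinds of boundary are locally graphs of Lipschitz functions, and the formula (DT) already
holds for bounded open sets of that kind. A finite partition of unity on the closure of `Ω` reduces
it to a field supported in one chart, where `Ω` is the region below a Lipschitz graph
(`IsLipschitzChart.divergence_theorem`). There, each slice parallel to the graph, at depth `s > 0`,
carries a Lipschitz compactly supported function, whose directional derivatives integrate to zero.
By the chain rule this trades every derivative of the field for a vertical one, weighted by `τ - ∂_v
γ`. Vertical derivatives integrate by the fundamental theorem of calculus to boundary values
(`IsC1BelowGraph.setIntegral_subgraph`). No smoothing of `γ` is needed. The weights assemble into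
the unnormalized normal `(-∇γ, 1)`. Its length is the density `√(1 + |∇γ|²)` of Hausdorff measure on
the graph, by the area formula `graphMeasure_eq_withDensity`. By Rademacher's theorem `γ` is
differentiable almost everywhere, and at such points the normalized vector is the outward unit
normal (`IsLipschitzChart.isOutwardUnitNormal`). -/

noncomputable section

/-! ### Area formula for Lipschitz graphs. -/

section AreaFormula

set_option linter.unusedSectionVars false

open scoped NNReal ENNReal RealInnerProductSpace

variable {V : Type*} [NormedAddCommGroup V] [InnerProductSpace ℝ V]

/-- The parametrization `x ↦ (x, γ x)` of the graph of `γ`. -/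
def graphMap (γ : V → ℝ) (x : V) : WithLp 2 (V × ℝ) := WithLp.toLp 2 (x, γ x)

@[simp] theorem graphMap_fst (γ : V → ℝ) (x : V) : (graphMap γ x).fst = x := rfl

@[simp] theorem graphMap_snd (γ : V → ℝ) (x : V) : (graphMap γ x).snd = γ x := rfl

theorem dist_graphMap (γ : V → ℝ) (x y : V) :
    dist (graphMap γ x) (graphMap γ y) = √(‖x - y‖ ^ 2 + (γ x - γ y) ^ 2) := by
  rw [WithLp.prod_dist_eq_of_L2]
  simp [dist_eq_norm]

/-- Changing the height difference by at most `ε * ‖x - y‖` lengthens the chord by no more than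
that, and `‖x - y‖` is at most the old chord. -/
theorem dist_graphMap_le {γ β : V → ℝ} {ε : ℝ} {x y : V}
    (h : |(γ x - γ y) - (β x - β y)| ≤ ε * ‖x - y‖) :
    dist (graphMap γ x) (graphMap γ y) ≤ (1 + ε) * dist (graphMap β x) (graphMap β y) := by
  rw [dist_graphMap, dist_graphMap]
  set N := ‖x - y‖
  set c := γ x - γ y
  set b := β x - β y
  set s := √(N ^ 2 + b ^ 2) with hs
  have hN : 0 ≤ N := norm_nonneg _
  have hs0 : 0 ≤ s := Real.sqrt_nonneg _
  have hss : s ^ 2 = N ^ 2 + b ^ 2 := Real.sq_sqrt (by positivity)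
  have hNs : N ≤ s := Real.le_sqrt_of_sq_le (by nlinarith [sq_nonneg b])
  have hbs : |b| ≤ s := Real.abs_le_sqrt (by nlinarith [sq_nonneg N])
  have he : 0 ≤ ε * N := (abs_nonneg _).trans h
  have hcb : |c| ≤ |b| + ε * N := by
    have := abs_add_le (c - b) b
    rw [sub_add_cancel] at this
    linarith
  have h1 : √(N ^ 2 + c ^ 2) ≤ s + ε * N := by
    apply Real.sqrt_le_iff.mpr ⟨by positivity, ?_⟩
    have h2 : c ^ 2 ≤ (|b| + ε * N) ^ 2 := by
      rw [← sq_abs c]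
      exact pow_le_pow_left₀ (abs_nonneg _) hcb 2
    have h3 : |b| * (ε * N) ≤ s * (ε * N) := mul_le_mul_of_nonneg_right hbs he
    nlinarith [sq_abs b]
  -- The sign of `ε` is not assumed and follows from `h` only when `x ≠ y`.
  rcases hN.eq_or_lt with h0 | h0
  · rw [← h0] at h1 h he
    have : |c - b| ≤ 0 := by simpa using h
    have : c = b := by simpa [sub_eq_zero] using this
    have hb : √(N ^ 2 + c ^ 2) = s := by rw [hs, this]
    have hxy : x = y := by simpa [N, sub_eq_zero] using h0.symm
    have hb0 : b = 0 := by simp [b, hxy]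
    have : s = 0 := by rw [hs, ← h0, hb0]; simp
    rw [hb, this]; simp
  · have hε : 0 ≤ ε := nonneg_of_mul_nonneg_left he h0
    nlinarith [mul_le_mul_of_nonneg_left hNs hε]

variable [MeasurableSpace V] [BorelSpace V] [FiniteDimensional ℝ V]

/-- The vertical projection from one graph to the other is `(1 + ε)`-Lipschitz over `S`. -/
theorem euclideanHausdorffMeasure_graphMap_image_le {γ β : V → ℝ} {ε : ℝ≥0} {S : Set V}
    (h : ∀ x ∈ S, ∀ y ∈ S, |(γ x - γ y) - (β x - β y)| ≤ ε * ‖x - y‖) (k : ℕ) :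
    (μHE[k] : Measure (WithLp 2 (V × ℝ))) (graphMap γ '' S) ≤
      (1 + ε : ℝ≥0∞) ^ k * μHE[k] (graphMap β '' S) := by
  have himg : graphMap γ '' S = (fun p => graphMap γ p.fst) '' (graphMap β '' S) := by
    rw [image_image]; rfl
  have hlip : LipschitzOnWith (1 + ε) (fun p : WithLp 2 (V × ℝ) => graphMap γ p.fst)
      (graphMap β '' S) := by
    apply LipschitzOnWith.of_dist_le_mul
    rintro _ ⟨x, hx, rfl⟩ _ ⟨y, hy, rfl⟩
    simpa using dist_graphMap_le (h x hx y hy)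
  have := hlip.hausdorffMeasure_image_le (Nat.cast_nonneg k)
  rw [← himg] at this
  rw [Measure.euclideanHausdorffMeasure_def, Measure.smul_apply, Measure.smul_apply,
    ENNReal.smul_def, ENNReal.smul_def, smul_eq_mul, smul_eq_mul, mul_left_comm]
  gcongr
  simpa using this

/-- The area density `√(1 + ‖∇γ‖²)` of the graph of `γ`. -/
def graphDensity (γ : V → ℝ) (x : V) : ℝ := √(1 + ‖fderiv ℝ γ x‖ ^ 2)

/-- The function `t ↦ √(1 + t²)` is 1-Lipschitz and at least 1, so an additive error `ε` in the
slope costs at most a factor `1 + ε`. -/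
theorem graphDensity_le {γ : V → ℝ} {a : V →L[ℝ] ℝ} {x : V} {ε : ℝ}
    (h : ‖fderiv ℝ γ x - a‖ ≤ ε) :
    graphDensity γ x ≤ (1 + ε) * √(1 + ‖a‖ ^ 2) ∧
    √(1 + ‖a‖ ^ 2) ≤ (1 + ε) * graphDensity γ x := by
  have key : ∀ s t : ℝ, 0 ≤ s → 0 ≤ t → s ≤ t + ε →
      √(1 + s ^ 2) ≤ (1 + ε) * √(1 + t ^ 2) := by
    intro s t hs ht hst
    have hε : 0 ≤ ε := (norm_nonneg _).trans h
    have h1 : 1 ≤ √(1 + t ^ 2) := Real.one_le_sqrt.mpr (by nlinarith)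
    have h2 : t ≤ √(1 + t ^ 2) := Real.le_sqrt_of_sq_le (by nlinarith)
    have h3 : √(1 + t ^ 2) ^ 2 = 1 + t ^ 2 := Real.sq_sqrt (by positivity)
    apply Real.sqrt_le_iff.mpr ⟨by positivity, ?_⟩
    have : s ^ 2 ≤ (t + ε) ^ 2 := pow_le_pow_left₀ hs hst 2
    rw [mul_pow, h3]
    nlinarith [mul_nonneg hε (sq_nonneg (t - 1)), mul_nonneg hε (sq_nonneg t),
      mul_nonneg (sq_nonneg ε) (sq_nonneg t)]
  have h1 := norm_sub_norm_le (fderiv ℝ γ x) a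
  have h2 := norm_sub_norm_le a (fderiv ℝ γ x)
  rw [norm_sub_rev] at h2
  exact ⟨key _ _ (norm_nonneg _) (norm_nonneg _) (by linarith),
    key _ _ (norm_nonneg _) (norm_nonneg _) (by linarith)⟩

/-- The images of an orthonormal basis have Gram matrix `1 + v vᵀ` with `v i = a (b i)`; the matrix
determinant lemma gives `1 + |v|²`. -/
theorem normDet_graph (a : V →L[ℝ] ℝ) (L : V →ₗ[ℝ] WithLp 2 (V × ℝ))
    (hL : ∀ x, L x = graphMap a x) : L.normDet = √(1 + ‖a‖ ^ 2) := by
  let b := stdOrthonormalBasis ℝ V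
  have h := L.normDet_sq_eq_det_gram b
  have hg : Matrix.gram ℝ (fun i => L (b i)) =
      1 + Matrix.replicateCol Unit (fun i => a (b i)) * Matrix.replicateRow Unit
        (fun i => a (b i)) := by
    ext i j
    simp only [Matrix.gram_apply, hL, WithLp.prod_inner_apply, Matrix.add_apply, Matrix.mul_apply]
    have := orthonormal_iff_ite.mp b.orthonormal i j
    simp [graphMap, Matrix.one_apply, this, mul_comm]
  have hnorm : ‖a‖ ^ 2 = ∑ i, a (b i) ^ 2 := by
    have h1 : ‖a‖ = ‖(InnerProductSpace.toDual ℝ V).symm a‖ := by simp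
    rw [h1, ← b.sum_sq_norm_inner_left]
    simp
  rw [hg, Matrix.det_one_add_replicateCol_mul_replicateRow] at h
  have h' : L.normDet ^ 2 = 1 + ‖a‖ ^ 2 := by
    rw [hnorm]
    simpa [dotProduct, sq] using h
  rw [← h', Real.sqrt_sq L.normDet_nonneg]

theorem euclideanHausdorffMeasure_graphMap_image_linear (a : V →L[ℝ] ℝ) (S : Set V) :
    (μHE[Module.finrank ℝ V] : Measure (WithLp 2 (V × ℝ))) (graphMap a '' S) =
      ENNReal.ofReal (√(1 + ‖a‖ ^ 2)) * volume S := by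
  let L : V →ₗ[ℝ] WithLp 2 (V × ℝ) :=
    { toFun := graphMap a
      map_add' := fun x y => by simp [graphMap, ← WithLp.toLp_add]
      map_smul' := fun c x => by simp [graphMap, ← WithLp.toLp_smul] }
  have := L.euclideanHausdorffMeasure_image_eq_normDet_mul_volume S
  rw [normDet_graph a L fun _ => rfl] at this
  exact this

theorem MeasureTheory.Measure.le_of_countable_cover {α ι : Type*} [MeasurableSpace α] [Countable ι]
    {ν ρ : Measure α} {P : ι → Set α} (hP : ∀ i, MeasurableSet (P i)) (hcov : ⋃ i, P i = univ)
    (h : ∀ i, ∀ T ⊆ P i, MeasurableSet T → ν T ≤ ρ T) : ν ≤ ρ := by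
  rcases isEmpty_or_nonempty ι with hι | hι
  · have : IsEmpty α := by
      rw [← univ_eq_empty_iff, ← hcov]; simp
    simp [Measure.eq_zero_of_isEmpty]
  obtain ⟨e, he⟩ := exists_surjective_nat ι
  have hQ : ⋃ n, disjointed (fun n => P (e n)) n = univ := by
    rw [iUnion_disjointed, he.iUnion_comp P, hcov]
  have hm : ∀ n, MeasurableSet (disjointed (fun n => P (e n)) n) :=
    MeasurableSet.disjointed fun n => hP _
  refine Measure.le_iff.mpr fun S hS => ?_
  have split : ∀ μ : Measure α, μ S = ∑' n, μ (S ∩ disjointed (fun n => P (e n)) n) := by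
    intro μ
    rw [← measure_iUnion _ fun n => hS.inter (hm n), ← inter_iUnion, hQ, inter_univ]
    exact fun i j hij => (disjoint_disjointed _ hij).mono inter_subset_right inter_subset_right
  rw [split ν, split ρ]
  exact ENNReal.tsum_le_tsum fun n => h (e n) _
    (inter_subset_right.trans (disjointed_le _ n)) (hS.inter (hm n))

theorem isClosedEmbedding_graphMap {γ : V → ℝ} (hγ : Continuous γ) :
    Topology.IsClosedEmbedding (graphMap γ) := by
  have hc : Continuous (graphMap γ) := by
    unfold graphMap; fun_prop
  apply Topology.IsClosedEmbedding.of_continuous_injective_isClosedMap hc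
  · intro x y h
    simpa using congrArg WithLp.fst h
  · intro S hS
    have : graphMap γ '' S =
        {p : WithLp 2 (V × ℝ) | p.fst ∈ S} ∩ {p : WithLp 2 (V × ℝ) | p.snd = γ p.fst} := by
      ext p
      constructor
      · rintro ⟨x, hx, rfl⟩
        exact ⟨hx, rfl⟩
      · rintro ⟨hp, hp'⟩
        refine ⟨p.fst, hp, ?_⟩
        have : p.snd = γ p.fst := hp'
        apply (WithLp.ofLp_injective 2)
        exact Prod.ext rfl this.symm
    rw [this]
    have hfst : Continuous fun p : WithLp 2 (V × ℝ) => p.fst :=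
      continuous_fst.comp (WithLp.prod_continuous_ofLp 2 V ℝ)
    have hsnd : Continuous fun p : WithLp 2 (V × ℝ) => p.snd :=
      continuous_snd.comp (WithLp.prod_continuous_ofLp 2 V ℝ)
    exact (hS.preimage hfst).inter (isClosed_eq hsnd (hγ.comp hfst))

/-- The surface measure of the graph of `γ`, as a measure on the base. -/
def graphMeasure (γ : V → ℝ) : Measure V :=
  Measure.comap (graphMap γ) (μHE[Module.finrank ℝ V] : Measure (WithLp 2 (V × ℝ)))

theorem graphMeasure_apply {γ : V → ℝ} (hγ : Continuous γ) (S : Set V) :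
    graphMeasure γ S = (μHE[Module.finrank ℝ V] : Measure (WithLp 2 (V × ℝ))) (graphMap γ '' S) :=
  (isClosedEmbedding_graphMap hγ).measurableEmbedding.comap_apply _ _

theorem graphMeasure_absolutelyContinuous {γ : V → ℝ} {K : ℝ≥0} (hγ : LipschitzWith K γ) :
    graphMeasure γ ≪ volume := by
  intro S hS
  -- A `K`-Lipschitz graph is compared with the flat one.
  have h := euclideanHausdorffMeasure_graphMap_image_le (γ := γ) (β := (0 : V →L[ℝ] ℝ)) (ε := K)
    (S := S) (fun x _ y _ => by simpa [dist_eq_norm] using hγ.dist_le_mul x y)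
    (Module.finrank ℝ V)
  rw [euclideanHausdorffMeasure_graphMap_image_linear, hS] at h
  rw [graphMeasure_apply hγ.continuous]
  simpa using h

theorem measurable_graphDensity (γ : V → ℝ) : Measurable (graphDensity γ) := by
  unfold graphDensity
  have := measurable_fderiv ℝ γ
  fun_prop

/-- The piece `none` is the set of non-differentiability, null for both measures. On the others `γ`
is nearly linear and its derivative nearly constant, so the linear case applies up to factors:
`finrank` of them from the Hausdorff measure, one from the density. -/
theorem exists_cover_graphMeasure_comparable {γ : V → ℝ} {K : ℝ≥0} (hγ : LipschitzWith K γ)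
    {ε : ℝ≥0} (hε : 0 < ε) :
    ∃ P : Option (ℕ × ℕ) → Set V, (∀ i, MeasurableSet (P i)) ∧ ⋃ i, P i = univ ∧
      ∀ i, ∀ T ⊆ P i, MeasurableSet T →
        graphMeasure γ T ≤ (1 + ε : ℝ≥0∞) ^ (Module.finrank ℝ V + 1) *
          ∫⁻ x in T, ENNReal.ofReal (graphDensity γ x) ∧
        ∫⁻ x in T, ENNReal.ofReal (graphDensity γ x) ≤
          (1 + ε : ℝ≥0∞) ^ (Module.finrank ℝ V + 1) * graphMeasure γ T := by
  set D := {x | DifferentiableAt ℝ γ x} with hD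
  have hDm : MeasurableSet D := measurableSet_of_differentiableAt ℝ γ
  have hD0 : volume Dᶜ = 0 := hγ.ae_differentiableAt
  -- Approximate linearity on a set does not control the derivative at each of its points; sorting
  -- points by the nearest `q m` does.
  let q : ℕ → (V →L[ℝ] ℝ) := TopologicalSpace.denseSeq _
  let s : ℕ → Set V := fun m => D ∩ {x | ‖fderiv ℝ γ x - q m‖ < ε / 2}
  have hsm : ∀ m, MeasurableSet (s m) := fun m => by
    have := measurable_fderiv ℝ γ
    exact hDm.inter (measurableSet_lt (by fun_prop) measurable_const)
  have hpart := fun m => exists_partition_approximatesLinearOn_of_hasFDerivWithinAt γ (s m)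
    (fderiv ℝ γ) (fun x hx => hx.1.hasFDerivAt.hasFDerivWithinAt) (fun _ => ε) (fun _ => hε.ne')
  choose t A _ htm hcov happ hA using hpart
  refine ⟨fun i => i.elim Dᶜ fun p => s p.1 ∩ t p.1 p.2, ?_, ?_, ?_⟩
  · rintro (_ | ⟨m, n⟩)
    · exact hDm.compl
    · exact (hsm m).inter (htm m n)
  · refine eq_univ_of_forall fun x => ?_
    by_cases hx : x ∈ D
    · obtain ⟨m, hm⟩ := (TopologicalSpace.denseRange_denseSeq (V →L[ℝ] ℝ)).exists_dist_lt
        (fderiv ℝ γ x) (show (0 : ℝ) < ε / 2 by positivity)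
      have hxs : x ∈ s m := ⟨hx, by rw [dist_eq_norm] at hm; exact hm⟩
      obtain ⟨n, hn⟩ := mem_iUnion.mp (hcov m hxs)
      exact mem_iUnion.mpr ⟨some (m, n), hxs, hn⟩
    · exact mem_iUnion.mpr ⟨none, hx⟩
  · rintro (_ | ⟨m, n⟩) T hT hTm
    · have h0 : volume T = 0 := measure_mono_null hT hD0
      simp [graphMeasure_absolutelyContinuous hγ h0, Measure.restrict_eq_zero.mpr h0]
    · replace hT : T ⊆ s m ∩ t m n := hT
      have hclose : ∀ x ∈ T, ‖fderiv ℝ γ x - A m n‖ ≤ ε := by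
        intro x hx
        -- `A m n` is itself a derivative of `γ` at a point of `s m`, hence within `ε / 2 + ε / 2`
        -- of the derivative at `x`.
        obtain ⟨y, hy, hAy⟩ := hA m ⟨x, (hT hx).1⟩ n
        have h1 : ‖fderiv ℝ γ x - q m‖ < ε / 2 := (hT hx).1.2
        have h2 : ‖fderiv ℝ γ y - q m‖ < ε / 2 := hy.2
        rw [hAy]
        have := norm_sub_le (fderiv ℝ γ x - q m) (fderiv ℝ γ y - q m)
        rw [sub_sub_sub_cancel_right] at this
        linarith
      have happ' : ∀ x ∈ T, ∀ y ∈ T,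
          |(γ x - γ y) - (A m n x - A m n y)| ≤ ε * ‖x - y‖ := by
        intro x hx y hy
        simpa using happ m n x (hT hx) y (hT hy)
      have hc : (1 + ε : ℝ≥0∞) = ENNReal.ofReal (1 + ε) := by
        rw [ENNReal.ofReal_add zero_le_one ε.coe_nonneg]; simp
      rw [graphMeasure_apply hγ.continuous]
      have hconst : ENNReal.ofReal √(1 + ‖A m n‖ ^ 2) * volume T =
          ∫⁻ x in T, ENNReal.ofReal √(1 + ‖A m n‖ ^ 2) := by simp
      constructor
      · refine (euclideanHausdorffMeasure_graphMap_image_le happ' _).trans ?_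
        rw [pow_succ, mul_assoc, euclideanHausdorffMeasure_graphMap_image_linear, hconst]
        gcongr
        rw [← lintegral_const_mul _ (measurable_graphDensity γ).ennreal_ofReal]
        refine setLIntegral_mono' hTm fun x hx => ?_
        rw [hc, ← ENNReal.ofReal_mul (by positivity)]
        exact ENNReal.ofReal_le_ofReal (graphDensity_le (hclose x hx)).2
      · have h1 := euclideanHausdorffMeasure_graphMap_image_le (γ := A m n) (β := γ) (ε := ε)
          (S := T) (fun x hx y hy => by rw [abs_sub_comm]; exact happ' x hx y hy)
          (Module.finrank ℝ V)
        rw [euclideanHausdorffMeasure_graphMap_image_linear, hconst] at h1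
        rw [pow_succ', mul_assoc]
        refine le_trans ?_ (mul_le_mul_right h1 _)
        rw [← lintegral_const_mul' _ _ (by simp)]
        refine setLIntegral_mono' hTm fun x hx => ?_
        rw [hc, ← ENNReal.ofReal_mul (by positivity)]
        exact ENNReal.ofReal_le_ofReal (graphDensity_le (hclose x hx)).1

theorem ENNReal.le_of_forall_one_add_pow_mul {a b : ℝ≥0∞} (n : ℕ)
    (h : ∀ ε : ℝ≥0, 0 < ε → a ≤ (1 + ε : ℝ≥0∞) ^ n * b) : a ≤ b := by
  have hl : Tendsto (fun ε : ℝ≥0 => (1 + ε : ℝ≥0∞) ^ n * b) (𝓝[>] 0)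
      (𝓝 ((1 + (0 : ℝ≥0) : ℝ≥0∞) ^ n * b)) := by
    apply Tendsto.mono_left _ nhdsWithin_le_nhds
    apply ENNReal.Tendsto.mul_const
    · have : Continuous fun ε : ℝ≥0 => (1 + ε : ℝ≥0∞) ^ n :=
        (ENNReal.continuous_pow n).comp (continuous_const.add ENNReal.continuous_coe)
      exact this.tendsto 0
    · simp
  rw [ENNReal.coe_zero, add_zero, one_pow, one_mul] at hl
  exact ge_of_tendsto hl (eventually_mem_nhdsWithin.mono fun ε hε => h ε hε)

/-- The area formula for the graph of a Lipschitz function. -/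
theorem graphMeasure_eq_withDensity {γ : V → ℝ} {K : ℝ≥0} (hγ : LipschitzWith K γ) :
    graphMeasure γ = volume.withDensity fun x => ENNReal.ofReal (graphDensity γ x) := by
  set ρ := volume.withDensity fun x => ENNReal.ofReal (graphDensity γ x)
  have key : ∀ ε : ℝ≥0, 0 < ε →
      graphMeasure γ ≤ (1 + ε : ℝ≥0∞) ^ (Module.finrank ℝ V + 1) • ρ ∧
      ρ ≤ (1 + ε : ℝ≥0∞) ^ (Module.finrank ℝ V + 1) • graphMeasure γ := by
    intro ε hε
    obtain ⟨P, hPm, hP, h⟩ := exists_cover_graphMeasure_comparable hγ hε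
    constructor
    · refine Measure.le_of_countable_cover hPm hP fun i T hT hTm => ?_
      simpa [ρ, withDensity_apply _ hTm] using (h i T hT hTm).1
    · refine Measure.le_of_countable_cover hPm hP fun i T hT hTm => ?_
      simpa [ρ, withDensity_apply _ hTm] using (h i T hT hTm).2
  apply le_antisymm
  · exact fun S => ENNReal.le_of_forall_one_add_pow_mul _ fun ε hε => by
      simpa using (key ε hε).1 S
  · exact fun S => ENNReal.le_of_forall_one_add_pow_mul _ fun ε hε => by
      simpa using (key ε hε).2 S

theorem restrict_range_graphMap {γ : V → ℝ} {K : ℝ≥0} (hγ : LipschitzWith K γ) :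
    (μHE[Module.finrank ℝ V] : Measure (WithLp 2 (V × ℝ))).restrict (range (graphMap γ)) =
      (volume.withDensity fun x => ENNReal.ofReal (graphDensity γ x)).map (graphMap γ) := by
  rw [← graphMeasure_eq_withDensity hγ, graphMeasure,
    (isClosedEmbedding_graphMap hγ.continuous).measurableEmbedding.map_comap]

end AreaFormula
end

noncomputable section

/-! ### Divergence theorem below a Lipschitz graph, for scalar functions. -/

section Subgraph

set_option linter.unusedSectionVars false

open scoped NNReal ENNReal

theorem ContinuousOn.integrableOn_of_eq_zero_off_compact {X E : Type*} [TopologicalSpace X]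
    [T2Space X] [MeasurableSpace X] [BorelSpace X] [NormedAddCommGroup E]
    {μ : Measure X} [IsFiniteMeasureOnCompacts μ] {g : X → E} {C k : Set X}
    (hg : ContinuousOn g C) (hC : IsClosed C) (hk : IsCompact k) (h0 : ∀ x ∉ k, g x = 0) :
    IntegrableOn g C μ := by
  have h1 : IntegrableOn g (k ∩ C) μ :=
    (hg.mono inter_subset_right).integrableOn_compact' (hk.inter_right hC)
      (hk.inter_right hC).measurableSet
  exact h1.of_forall_sdiff_eq_zero hC.measurableSet fun x hx => h0 x fun hxk => hx.2 ⟨hxk, hx.1⟩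

variable {V : Type*} [NormedAddCommGroup V] [NormedSpace ℝ V]

/-- `f` is continuously differentiable with derivative `f'` up to the boundary of the region below
the graph of `γ`, and both vanish off the compact set `k`. -/
structure IsC1BelowGraph (γ : V → ℝ) (f : V × ℝ → ℝ) (f' : V × ℝ → V × ℝ →L[ℝ] ℝ)
    (k : Set (V × ℝ)) : Prop where
  continuousOn : ContinuousOn f {p | p.2 ≤ γ p.1}
  continuousOn_deriv : ContinuousOn f' {p | p.2 ≤ γ p.1}
  hasFDerivAt : ∀ p : V × ℝ, p.2 < γ p.1 → HasFDerivAt f (f' p) p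
  isCompact : IsCompact k
  eq_zero : ∀ p ∉ k, f p = 0
  deriv_eq_zero : ∀ p ∉ k, f' p = 0

/-- The shear exchanging the region below the graph of `γ` with the upper half space. -/
def graphShear (γ : V → ℝ) (p : V × ℝ) : V × ℝ := (p.1, γ p.1 - p.2)

theorem graphShear_involutive (γ : V → ℝ) : Function.Involutive (graphShear γ) := fun p => by
  simp [graphShear]

theorem continuous_graphShear {γ : V → ℝ} (hγ : Continuous γ) : Continuous (graphShear γ) := by
  unfold graphShear; fun_prop

theorem isCompact_graphShear_preimage {γ : V → ℝ} (hγ : Continuous γ) {k : Set (V × ℝ)}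
    (hk : IsCompact k) : IsCompact (graphShear γ ⁻¹' k) := by
  rw [← (graphShear_involutive γ).image_eq_preimage_symm]
  exact hk.image (continuous_graphShear hγ)

namespace IsC1BelowGraph

variable {γ : V → ℝ} {K : ℝ≥0} {f : V × ℝ → ℝ} {f' : V × ℝ → V × ℝ →L[ℝ] ℝ} {k : Set (V × ℝ)}

theorem exists_bound (h : IsC1BelowGraph γ f f' k) (hγ : Continuous γ) :
    ∃ C : ℝ, 0 ≤ C ∧ ∀ p : V × ℝ, p.2 ≤ γ p.1 → ‖f' p‖ ≤ C := by
  have hcl : IsClosed {p : V × ℝ | p.2 ≤ γ p.1} := isClosed_le (by fun_prop) (by fun_prop)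
  obtain ⟨C, hC⟩ := (h.isCompact.inter_right hcl).exists_bound_of_continuousOn
    (h.continuousOn_deriv.mono inter_subset_right)
  refine ⟨max C 0, le_max_right _ _, fun p hp => ?_⟩
  by_cases hpk : p ∈ k
  · exact (hC p ⟨hpk, hp⟩).trans (le_max_left _ _)
  · rw [h.deriv_eq_zero p hpk, norm_zero]
    exact le_max_right _ _

/-- The segment joining two points of the slice may cross the graph. The path through `(y, γ x - s -
K * D)` stays below it: it descends with slope `K`, then moves vertically. The mean value inequality
applies on both legs, of lengths at most `(1 + K) * D` and `2 * K * D`. -/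
theorem exists_lipschitzWith (h : IsC1BelowGraph γ f f' k) (hγ : LipschitzWith K γ) {s : ℝ}
    (hs : 0 < s) : ∃ C, LipschitzWith C fun x => f (x, γ x - s) := by
  obtain ⟨C, hC0, hC⟩ := h.exists_bound hγ.continuous
  have seg : ∀ p q : V × ℝ, (∀ t ∈ Icc (0 : ℝ) 1,
      (p + t • (q - p)).2 < γ (p + t • (q - p)).1) → |f q - f p| ≤ C * ‖q - p‖ := by
    intro p q hpq
    have hsub : ∀ r ∈ segment ℝ p q, r.2 < γ r.1 := by
      intro r hr
      rw [segment_eq_image'] at hr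
      obtain ⟨t, ht, rfl⟩ := hr
      exact hpq t ht
    exact (convex_segment p q).norm_image_sub_le_of_norm_hasFDerivWithin_le
      (fun r hr => (h.hasFDerivAt r (hsub r hr)).hasFDerivWithinAt)
      (fun r hr => hC r (hsub r hr).le) (left_mem_segment ℝ p q) (right_mem_segment ℝ p q)
  refine ⟨⟨C * ((1 + K) + 2 * K), by positivity⟩, LipschitzWith.of_dist_le_mul fun x y => ?_⟩
  have hlip : ∀ u w, |γ u - γ w| ≤ K * ‖u - w‖ := fun u w => by
    simpa [dist_eq_norm] using hγ.dist_le_mul u w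
  set D := ‖y - x‖ with hD
  have h1 := seg (x, γ x - s) (y, γ x - s - K * D) (by
    rintro t ⟨ht0, ht1⟩
    have := (abs_le.mp (hlip (x + t • (y - x)) x)).1
    rw [add_sub_cancel_left, norm_smul, Real.norm_eq_abs, abs_of_nonneg ht0] at this
    simp only [Prod.mk_sub_mk, Prod.smul_mk, Prod.mk_add_mk, smul_eq_mul]
    nlinarith)
  have h2 := seg (y, γ x - s - K * D) (y, γ y - s) (by
    rintro t ⟨ht0, ht1⟩
    have := (abs_le.mp (hlip y x)).1
    simp only [Prod.mk_sub_mk, Prod.smul_mk, Prod.mk_add_mk, smul_eq_mul, sub_self, smul_zero,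
      add_zero]
    nlinarith)
  have hK : (0 : ℝ) ≤ K := K.2
  have hD0 : 0 ≤ D := norm_nonneg _
  have n1 : ‖((y, γ x - s - K * D) : V × ℝ) - (x, γ x - s)‖ ≤ (1 + K) * D := by
    rw [Prod.mk_sub_mk, Prod.norm_mk]
    refine max_le (by nlinarith) ?_
    rw [Real.norm_eq_abs, sub_sub_cancel_left, abs_neg, abs_of_nonneg (by positivity)]
    nlinarith
  have n2 : ‖((y, γ y - s) : V × ℝ) - (y, γ x - s - K * D)‖ ≤ 2 * K * D := by
    rw [Prod.mk_sub_mk, Prod.norm_mk]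
    refine max_le (by simp; positivity) ?_
    have := abs_le.mp (hlip y x)
    rw [Real.norm_eq_abs, abs_le]
    constructor <;> linarith
  have m1 := mul_le_mul_of_nonneg_left n1 hC0
  have m2 := mul_le_mul_of_nonneg_left n2 hC0
  rw [dist_comm, dist_eq_norm, dist_comm, dist_eq_norm, Real.norm_eq_abs]
  change |f (y, γ y - s) - f (x, γ x - s)| ≤ C * ((1 + K) + 2 * K) * D
  calc _ = |(f (y, γ y - s) - f (y, γ x - s - K * D)) +
        (f (y, γ x - s - K * D) - f (x, γ x - s))| := by congr 1; ring
    _ ≤ _ := abs_add_le _ _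
    _ ≤ _ := by linarith

variable [MeasurableSpace V] [BorelSpace V] [FiniteDimensional ℝ V]
variable {μ : Measure V} [μ.IsAddHaarMeasure]

theorem hasCompactSupport_slice (h : IsC1BelowGraph γ f f' k) (s : ℝ) :
    HasCompactSupport fun x => f (x, γ x - s) :=
  HasCompactSupport.intro (h.isCompact.image continuous_fst) fun _ hx =>
    h.eq_zero _ fun hk => hx ⟨_, hk, rfl⟩

theorem integral_lineDeriv_slice (h : IsC1BelowGraph γ f f' k) (hγ : LipschitzWith K γ) {s : ℝ}
    (hs : 0 < s) (v : V) : ∫ x, lineDeriv ℝ (fun x => f (x, γ x - s)) x v ∂μ = 0 := by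
  obtain ⟨C, hC⟩ := h.exists_lipschitzWith hγ hs
  -- Integration by parts against the constant 1; it reverses the direction, hence `-v`.
  have := LipschitzWith.integral_lineDeriv_mul_eq (μ := μ) (LipschitzWith.const (1 : ℝ)) hC
    (h.hasCompactSupport_slice s) (-v)
  simpa [lineDeriv] using this.symm

theorem lineDeriv_slice (h : IsC1BelowGraph γ f f' k) {s : ℝ} (hs : 0 < s) (v : V) {x : V}
    (hx : DifferentiableAt ℝ γ x) : lineDeriv ℝ (fun x => f (x, γ x - s)) x v =
      f' (x, γ x - s) (v, 0) + lineDeriv ℝ γ x v * f' (x, γ x - s) (0, 1) := by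
  have h1 : HasFDerivAt (fun x => (x, γ x - s))
      ((ContinuousLinearMap.id ℝ V).prod (fderiv ℝ γ x)) x :=
    (hasFDerivAt_id x).prodMk (hx.hasFDerivAt.sub_const s)
  have h2 := (h.hasFDerivAt (x, γ x - s) (by simpa using hs)).comp x h1
  have h3 : lineDeriv ℝ (fun x => f (x, γ x - s)) x v = _ := (h2.hasLineDerivAt v).lineDeriv
  rw [h3, hx.lineDeriv_eq_fderiv]
  have : ((v, fderiv ℝ γ x v) : V × ℝ) = (v, 0) + fderiv ℝ γ x v • (0, 1) := by simp
  simp only [ContinuousLinearMap.comp_apply, ContinuousLinearMap.prod_apply,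
    ContinuousLinearMap.id_apply]
  rw [this, map_add, map_smul, smul_eq_mul]

theorem continuousOn_deriv_shear (h : IsC1BelowGraph γ f f' k) (hγ : Continuous γ) (w : V × ℝ) :
    ContinuousOn (fun p => f' (graphShear γ p) w) {p | 0 ≤ p.2} := by
  have := h.continuousOn_deriv.comp (continuous_graphShear hγ).continuousOn
    (s := {p | 0 ≤ p.2}) (fun p hp => by simpa [graphShear] using hp)
  exact this.clm_apply continuousOn_const

theorem integrableOn_deriv_shear (h : IsC1BelowGraph γ f f' k) (hγ : Continuous γ) (w : V × ℝ) :
    Integrable (fun p => f' (graphShear γ p) w) (μ.prod (volume.restrict (Ioi (0 : ℝ)))) := by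
  have h1 : IntegrableOn (fun p => f' (graphShear γ p) w) {p | 0 ≤ p.2} (μ.prod volume) :=
    (h.continuousOn_deriv_shear hγ w).integrableOn_of_eq_zero_off_compact
      (isClosed_le continuous_const continuous_snd) (isCompact_graphShear_preimage hγ h.isCompact)
      fun p hp => by rw [h.deriv_eq_zero _ hp]; rfl
  have h2 := h1.mono_set (s := univ ×ˢ Ioi (0 : ℝ)) fun p hp => (le_of_lt hp.2 : (0 : ℝ) ≤ p.2)
  rwa [IntegrableOn, ← Measure.prod_restrict, Measure.restrict_univ] at h2

theorem integrable_deriv_slice (h : IsC1BelowGraph γ f f' k) (hγ : Continuous γ) (w : V × ℝ)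
    {s : ℝ} (hs : 0 < s) : Integrable (fun x => f' (x, γ x - s) w) μ := by
  rw [← integrableOn_univ]
  have hc : ContinuousOn (fun x : V => f' (graphShear γ (x, s)) w) univ :=
    (h.continuousOn_deriv_shear hγ w).comp (by fun_prop) fun x _ => hs.le
  exact hc.integrableOn_of_eq_zero_off_compact isClosed_univ (h.isCompact.image continuous_fst)
    fun x hx => by
      rw [h.deriv_eq_zero _ fun hk => hx ⟨_, hk, rfl⟩]; rfl

theorem integrable_lineDeriv_mul {g : V → ℝ} (hγ : LipschitzWith K γ) (hg : Integrable g μ)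
    (v : V) (τ : ℝ) : Integrable (fun x => (τ - lineDeriv ℝ γ x v) * g x) μ := by
  refine hg.bdd_mul (c := |τ| + K * ‖v‖) ?_ ?_
  · exact (measurable_const.sub (measurable_lineDeriv hγ.continuous)).aestronglyMeasurable
  · refine ae_of_all _ fun x => ?_
    exact (norm_sub_le _ _).trans (add_le_add le_rfl (norm_lineDeriv_le_of_lipschitz ℝ hγ))

/-- By the chain rule the two integrands differ almost everywhere by the derivative of the slice in
direction `v`, whose integral is zero. -/
theorem integral_deriv_slice (h : IsC1BelowGraph γ f f' k) (hγ : LipschitzWith K γ) {s : ℝ}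
    (hs : 0 < s) (v : V) (τ : ℝ) : ∫ x, f' (x, γ x - s) (v, τ) ∂μ =
      ∫ x, (τ - lineDeriv ℝ γ x v) * f' (x, γ x - s) (0, 1) ∂μ := by
  rw [← sub_eq_zero, ← integral_sub (h.integrable_deriv_slice hγ.continuous _ hs)
    (integrable_lineDeriv_mul hγ (h.integrable_deriv_slice hγ.continuous _ hs) v τ),
    ← h.integral_lineDeriv_slice (μ := μ) hγ hs v]
  refine integral_congr_ae ?_
  filter_upwards [hγ.ae_differentiableAt] with x hx
  rw [h.lineDeriv_slice hs v hx]
  have : ((v, τ) : V × ℝ) = (v, 0) + τ • (0, 1) := by simp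
  rw [this, map_add, map_smul, smul_eq_mul]
  ring

/-- Fundamental theorem of calculus on the ray down from the graph: `f` vanishes far down, and at
the graph one-sided continuity suffices. -/
theorem integral_vertical (h : IsC1BelowGraph γ f f' k) (hγ : Continuous γ) (x : V) :
    ∫ s in Ioi (0 : ℝ), f' (x, γ x - s) (0, 1) = f (x, γ x) := by
  have hk : IsCompact ((fun s : ℝ => (x, γ x - s)) ⁻¹' k) := by
    have : (fun s : ℝ => (x, γ x - s)) ⁻¹' k ⊆ Prod.snd '' (graphShear γ ⁻¹' k) :=
      fun s hs => ⟨(x, s), hs, rfl⟩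
    exact ((isCompact_graphShear_preimage hγ h.isCompact).image continuous_snd).of_isClosed_subset
      (h.isCompact.isClosed.preimage (by fun_prop)) this
  have hint : IntegrableOn (fun s => -f' (x, γ x - s) (0, 1)) (Ioi (0 : ℝ)) := by
    have hc : ContinuousOn (fun s : ℝ => f' (graphShear γ (x, s)) (0, 1)) (Ici 0) :=
      (h.continuousOn_deriv_shear hγ _).comp (by fun_prop) fun s hs => hs
    exact ((hc.integrableOn_of_eq_zero_off_compact isClosed_Ici hk fun s hs => by
      rw [graphShear, h.deriv_eq_zero _ hs]; rfl).mono_set Ioi_subset_Ici_self).neg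
  have hcont : ContinuousWithinAt (fun s : ℝ => f (x, γ x - s)) (Ici 0) 0 := by
    have : ContinuousOn (fun s : ℝ => f (x, γ x - s)) (Ici 0) :=
      h.continuousOn.comp (by fun_prop) fun s hs => by simpa using hs
    exact this 0 self_mem_Ici
  have hlim : Tendsto (fun s : ℝ => f (x, γ x - s)) atTop (𝓝 0) := by
    apply tendsto_const_nhds.congr'
    obtain ⟨M, hM⟩ := hk.isBounded.bddAbove
    filter_upwards [eventually_gt_atTop M] with s hs
    exact (h.eq_zero _ fun hk => absurd (hM hk) (not_le.mpr hs)).symm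
  have := integral_Ioi_of_hasDerivAt_of_tendsto hcont (fun s hs => by
    have h1 : HasDerivAt (fun s : ℝ => (x, γ x - s)) ((0 : V), (-1 : ℝ)) s :=
      (hasDerivAt_const s x).prodMk ((hasDerivAt_id s).const_sub (γ x))
    have h2 := (h.hasFDerivAt (x, γ x - s) (by simpa using hs)).comp_hasDerivAt s h1
    have : ((0, -1) : V × ℝ) = -(0, 1) := by simp
    rw [this, map_neg] at h2
    exact h2) hint hlim
  rw [integral_neg] at this
  simpa using this

theorem integrable_trace (h : IsC1BelowGraph γ f f' k) (hγ : LipschitzWith K γ) (v : V) (τ : ℝ) :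
    Integrable (fun x => (τ - lineDeriv ℝ γ x v) * f (x, γ x)) μ := by
  apply integrable_lineDeriv_mul hγ
  rw [← integrableOn_univ]
  have hc := hγ.continuous
  have : ContinuousOn (fun x => f (x, γ x)) univ :=
    h.continuousOn.comp (by fun_prop) fun x _ => le_refl (γ x)
  exact this.integrableOn_of_eq_zero_off_compact isClosed_univ (h.isCompact.image continuous_fst)
    fun x hx => h.eq_zero _ fun hk => hx ⟨_, hk, rfl⟩

theorem measurePreserving_graphShear (hγ : Continuous γ) :
    MeasurePreserving (graphShear γ) (μ.prod volume) (μ.prod volume) :=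
  (MeasurePreserving.id μ).skew_product (g := fun x s => γ x - s)
    (by unfold Function.uncurry; fun_prop)
    (ae_of_all _ fun x => (volume.measurePreserving_sub_left (γ x)).map_eq)

theorem measurableEmbedding_graphShear (hγ : Continuous γ) :
    MeasurableEmbedding (graphShear γ) :=
  (MeasurableEquiv.ofInvolutive _ (graphShear_involutive γ)
    (continuous_graphShear hγ).measurable).measurableEmbedding

theorem graphShear_preimage_subgraph :
    graphShear γ ⁻¹' {p | p.2 < γ p.1} = univ ×ˢ Ioi (0 : ℝ) := by
  ext p; simp [graphShear]

theorem integrableOn_subgraph (h : IsC1BelowGraph γ f f' k) (hγ : Continuous γ) (w : V × ℝ) :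
    IntegrableOn (fun p => f' p w) {p | p.2 < γ p.1} (μ.prod volume) := by
  rw [← (measurePreserving_graphShear hγ).integrableOn_comp_preimage
    (measurableEmbedding_graphShear hγ), graphShear_preimage_subgraph, IntegrableOn,
    ← Measure.prod_restrict, Measure.restrict_univ]
  exact h.integrableOn_deriv_shear hγ w

/-- The divergence theorem below the graph of a Lipschitz function. -/
theorem setIntegral_subgraph (h : IsC1BelowGraph γ f f' k) (hγ : LipschitzWith K γ) (v : V)
    (τ : ℝ) : ∫ p in {p | p.2 < γ p.1}, f' p (v, τ) ∂(μ.prod volume) =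
      ∫ x, (τ - lineDeriv ℝ γ x v) * f (x, γ x) ∂μ := by
  have hc := hγ.continuous
  rw [← (measurePreserving_graphShear hc).setIntegral_preimage_emb
    (measurableEmbedding_graphShear hc), graphShear_preimage_subgraph,
    ← Measure.prod_restrict, Measure.restrict_univ,
    integral_prod_symm _ (h.integrableOn_deriv_shear hc _)]
  have h1 : Integrable (fun p : V × ℝ => (τ - lineDeriv ℝ γ p.1 v) * f' (graphShear γ p) (0, 1))
      (μ.prod (volume.restrict (Ioi (0 : ℝ)))) := by
    refine (h.integrableOn_deriv_shear hc _).bdd_mul (c := |τ| + K * ‖v‖) ?_ ?_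
    · exact (measurable_const.sub ((measurable_lineDeriv hc).comp
        measurable_fst)).aestronglyMeasurable
    · refine ae_of_all _ fun x => ?_
      exact (norm_sub_le _ _).trans (add_le_add le_rfl (norm_lineDeriv_le_of_lipschitz ℝ hγ))
  -- Slices come first, to make the derivative vertical; then Fubini turns to vertical rays, along
  -- which the weight is constant.
  calc _ = ∫ s in Ioi (0 : ℝ), ∫ x, (τ - lineDeriv ℝ γ x v) * f' (x, γ x - s) (0, 1) ∂μ :=
        setIntegral_congr_fun measurableSet_Ioi fun s hs => h.integral_deriv_slice hγ hs v τ
    _ = ∫ x, (∫ s in Ioi (0 : ℝ), (τ - lineDeriv ℝ γ x v) * f' (x, γ x - s) (0, 1)) ∂μ := by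
        exact (integral_prod_symm _ h1).symm.trans (integral_prod _ h1)
    _ = _ := by
        simp_rw [integral_const_mul, h.integral_vertical hc]

end IsC1BelowGraph

end Subgraph
end

noncomputable section

/-! ### Transfer to orthonormal coordinates and vector fields. -/

section Chart

set_option linter.unusedSectionVars false

open scoped NNReal ENNReal RealInnerProductSpace

variable {E V : Type*} [NormedAddCommGroup E] [InnerProductSpace ℝ E] [FiniteDimensional ℝ E]
  [MeasurableSpace E] [BorelSpace E] [NormedAddCommGroup V] [InnerProductSpace ℝ V]
  [FiniteDimensional ℝ V] [MeasurableSpace V] [BorelSpace V]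

/-- The region strictly below the graph of `γ` in the coordinates `φ`. -/
def subgraph (φ : E ≃ₗᵢ[ℝ] WithLp 2 (V × ℝ)) (γ : V → ℝ) : Set E :=
  {y | (φ y).snd < γ (φ y).fst}

/-- The region below the graph of `γ` in the coordinates `φ`, including the graph. -/
def closedSubgraph (φ : E ≃ₗᵢ[ℝ] WithLp 2 (V × ℝ)) (γ : V → ℝ) : Set E :=
  {y | (φ y).snd ≤ γ (φ y).fst}

/-- The point of the graph of `γ` above `x`, in the coordinates `φ`. -/
def graphPoint (φ : E ≃ₗᵢ[ℝ] WithLp 2 (V × ℝ)) (γ : V → ℝ) (x : V) : E :=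
  φ.symm (graphMap γ x)

/-- The upward normal `(-∇γ(x), 1)` to the graph of `γ`, in the coordinates `φ`. -/
def graphNormal (φ : E ≃ₗᵢ[ℝ] WithLp 2 (V × ℝ)) (γ : V → ℝ) (x : V) : E :=
  φ.symm (WithLp.toLp 2 (-gradient γ x, 1))

/-- The inverse of the coordinates `φ`, on the product space. -/
def chartSymm (φ : E ≃ₗᵢ[ℝ] WithLp 2 (V × ℝ)) : (V × ℝ) ≃L[ℝ] E :=
  (WithLp.prodContinuousLinearEquiv 2 ℝ V ℝ).symm.trans φ.symm.toContinuousLinearEquiv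

theorem chartSymm_apply (φ : E ≃ₗᵢ[ℝ] WithLp 2 (V × ℝ)) (p : V × ℝ) :
    chartSymm φ p = φ.symm (WithLp.toLp 2 p) := rfl

theorem chartSymm_symm_apply (φ : E ≃ₗᵢ[ℝ] WithLp 2 (V × ℝ)) (y : E) :
    (chartSymm φ).symm y = ((φ y).fst, (φ y).snd) := rfl

theorem measurePreserving_chartSymm (φ : E ≃ₗᵢ[ℝ] WithLp 2 (V × ℝ)) :
    MeasurePreserving (chartSymm φ) :=
  φ.symm.measurePreserving.comp (WithLp.volume_preserving_toLp V ℝ)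

theorem inner_graphNormal (φ : E ≃ₗᵢ[ℝ] WithLp 2 (V × ℝ)) (γ : V → ℝ) (x : V) (y : E) :
    ⟪graphNormal φ γ x, y⟫ = (φ y).snd - fderiv ℝ γ x (φ y).fst := by
  rw [graphNormal, ← φ.inner_map_map, φ.apply_symm_apply, WithLp.prod_inner_apply]
  simp [inner_neg_left, gradient]
  ring

/-- This is why the area density cancels the normalization of the normal in surface integrals. -/
theorem norm_graphNormal (φ : E ≃ₗᵢ[ℝ] WithLp 2 (V × ℝ)) (γ : V → ℝ) (x : V) :
    ‖graphNormal φ γ x‖ = graphDensity γ x := by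
  rw [graphNormal, φ.symm.norm_map, WithLp.prod_norm_eq_of_L2, graphDensity]
  simp [gradient, add_comm]

theorem graphDensity_pos (γ : V → ℝ) (x : V) : 0 < graphDensity γ x :=
  Real.sqrt_pos.mpr (by positivity)

/-- `H` is continuously differentiable with derivative `H'` up to the boundary of the region below
the graph of `γ` in the coordinates `φ`, and both vanish off the compact set `k`. -/
structure IsC1FieldBelowGraph (φ : E ≃ₗᵢ[ℝ] WithLp 2 (V × ℝ)) (γ : V → ℝ) (H : E → E)
    (H' : E → E →L[ℝ] E) (k : Set E) : Prop where
  continuousOn : ContinuousOn H (closedSubgraph φ γ)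
  continuousOn_deriv : ContinuousOn H' (closedSubgraph φ γ)
  hasFDerivAt : ∀ y ∈ subgraph φ γ, HasFDerivAt H (H' y) y
  isCompact : IsCompact k
  eq_zero : ∀ y ∉ k, H y = 0
  deriv_eq_zero : ∀ y ∉ k, H' y = 0

namespace IsC1FieldBelowGraph

variable {φ : E ≃ₗᵢ[ℝ] WithLp 2 (V × ℝ)} {γ : V → ℝ} {K : ℝ≥0} {H : E → E} {H' : E → E →L[ℝ] E}
  {k : Set E}

/-- The trace of `H'` is the sum of `⟪b, H' b⟫` over an orthonormal basis, so the scalar theorem is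
applied to each component. -/
theorem component (h : IsC1FieldBelowGraph φ γ H H' k) (b : E) :
    IsC1BelowGraph γ (fun p => ⟪b, H (chartSymm φ p)⟫)
      (fun p => (innerSL ℝ b).comp ((H' (chartSymm φ p)).comp (chartSymm φ : V × ℝ →L[ℝ] E)))
      (chartSymm φ ⁻¹' k) where
  continuousOn := continuousOn_const.inner
    (h.continuousOn.comp (chartSymm φ).continuous.continuousOn fun p hp => by
      simpa [closedSubgraph, chartSymm_apply] using hp)
  continuousOn_deriv := continuousOn_const.clm_comp
    ((h.continuousOn_deriv.comp (chartSymm φ).continuous.continuousOn fun p hp => by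
      simpa [closedSubgraph, chartSymm_apply] using hp).clm_comp continuousOn_const)
  hasFDerivAt p hp := by
    have h1 := h.hasFDerivAt (chartSymm φ p) (by simpa [subgraph, chartSymm_apply] using hp)
    exact (innerSL ℝ b).hasFDerivAt.comp p (h1.comp p (chartSymm φ).hasFDerivAt)
  isCompact := (chartSymm φ).toHomeomorph.isCompact_preimage.mpr h.isCompact
  eq_zero p hp := by simp [h.eq_zero _ hp]
  deriv_eq_zero p hp := by simp [h.deriv_eq_zero _ hp]

theorem chartSymm_preimage_subgraph :
    chartSymm φ ⁻¹' subgraph φ γ = {p : V × ℝ | p.2 < γ p.1} := by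
  ext p; simp [subgraph, chartSymm_apply]

theorem integrableOn_component (h : IsC1FieldBelowGraph φ γ H H' k) (hγ : LipschitzWith K γ)
    (b u : E) : IntegrableOn (fun y => ⟪b, H' y u⟫) (subgraph φ γ) := by
  rw [← (measurePreserving_chartSymm φ).integrableOn_comp_preimage
    (chartSymm φ).toHomeomorph.measurableEmbedding, chartSymm_preimage_subgraph]
  convert (h.component b).integrableOn_subgraph (μ := volume) hγ.continuous
    ((chartSymm φ).symm u) using 2 with p
  · simp
  · rfl

theorem setIntegral_component (h : IsC1FieldBelowGraph φ γ H H' k) (hγ : LipschitzWith K γ)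
    (b u : E) : ∫ y in subgraph φ γ, ⟪b, H' y u⟫ =
      ∫ x, ((φ u).snd - lineDeriv ℝ γ x (φ u).fst) * ⟪b, H (graphPoint φ γ x)⟫ := by
  rw [← (measurePreserving_chartSymm φ).setIntegral_preimage_emb
    (chartSymm φ).toHomeomorph.measurableEmbedding, chartSymm_preimage_subgraph]
  have := (h.component b).setIntegral_subgraph (μ := volume) hγ (φ u).fst (φ u).snd
  rw [← chartSymm_symm_apply φ u] at this
  simpa using! this

theorem integrableOn_trace (h : IsC1FieldBelowGraph φ γ H H' k) (hγ : LipschitzWith K γ) :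
    IntegrableOn (fun y => LinearMap.trace ℝ E (H' y)) (subgraph φ γ) := by
  simp_rw [LinearMap.trace_eq_sum_inner _ (stdOrthonormalBasis ℝ E)]
  exact integrable_finsetSum _ fun i _ => h.integrableOn_component hγ _ _

/-- Parseval's identity: where `γ` is differentiable, the first factor is the component of the
normal along the basis vector. -/
theorem sum_component_ae (hγ : LipschitzWith K γ) (H : E → E) :
    (fun x => ∑ i, ((φ (stdOrthonormalBasis ℝ E i)).snd -
      lineDeriv ℝ γ x (φ (stdOrthonormalBasis ℝ E i)).fst) *
        ⟪stdOrthonormalBasis ℝ E i, H (graphPoint φ γ x)⟫) =ᵐ[volume]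
    fun x => ⟪H (graphPoint φ γ x), graphNormal φ γ x⟫ := by
  filter_upwards [hγ.ae_differentiableAt] with x hx
  rw [real_inner_comm, ← (stdOrthonormalBasis ℝ E).sum_inner_mul_inner]
  simp_rw [inner_graphNormal, hx.lineDeriv_eq_fderiv]

theorem integrable_inner_graphNormal (h : IsC1FieldBelowGraph φ γ H H' k)
    (hγ : LipschitzWith K γ) :
    Integrable fun x => ⟪H (graphPoint φ γ x), graphNormal φ γ x⟫ :=
  (integrable_finsetSum _ fun i _ =>
    (h.component (stdOrthonormalBasis ℝ E i)).integrable_trace hγ _ _).congr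
      (sum_component_ae hγ H)

theorem setIntegral_trace (h : IsC1FieldBelowGraph φ γ H H' k) (hγ : LipschitzWith K γ) :
    ∫ y in subgraph φ γ, LinearMap.trace ℝ E (H' y) =
      ∫ x, ⟪H (graphPoint φ γ x), graphNormal φ γ x⟫ := by
  simp_rw [LinearMap.trace_eq_sum_inner _ (stdOrthonormalBasis ℝ E)]
  rw [← integral_congr_ae (sum_component_ae hγ H), integral_finsetSum, integral_finsetSum]
  · exact Finset.sum_congr rfl fun i _ => h.setIntegral_component hγ _ _
  · exact fun i _ => (h.component (stdOrthonormalBasis ℝ E i)).integrable_trace hγ _ _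
  · exact fun i _ => h.integrableOn_component hγ _ _

end IsC1FieldBelowGraph

theorem isClosedEmbedding_graphPoint (φ : E ≃ₗᵢ[ℝ] WithLp 2 (V × ℝ)) {γ : V → ℝ}
    (hγ : Continuous γ) : Topology.IsClosedEmbedding (graphPoint φ γ) :=
  φ.symm.toHomeomorph.isClosedEmbedding.comp (isClosedEmbedding_graphMap hγ)

theorem restrict_range_graphPoint (φ : E ≃ₗᵢ[ℝ] WithLp 2 (V × ℝ)) {γ : V → ℝ} {K : ℝ≥0}
    (hγ : LipschitzWith K γ) :
    (μHE[Module.finrank ℝ V] : Measure E).restrict (range (graphPoint φ γ)) =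
      (volume.withDensity fun x => ENNReal.ofReal (graphDensity γ x)).map (graphPoint φ γ) := by
  have hemb := (isClosedEmbedding_graphMap hγ.continuous).measurableEmbedding
  have hφ : MeasurableEmbedding φ.symm := φ.symm.toHomeomorph.measurableEmbedding
  have hmp := φ.symm.toIsometryEquiv.measurePreserving_euclideanHausdorffMeasure
    (Module.finrank ℝ V)
  have : graphPoint φ γ = φ.symm ∘ graphMap γ := rfl
  rw [this, ← Measure.map_map hφ.measurable hemb.measurable, ← restrict_range_graphMap hγ,
    range_comp]
  have h2 := hmp.restrict_image_emb hφ (range (graphMap γ))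
  exact h2.map_eq.symm

theorem integrableOn_range_graphPoint_iff (φ : E ≃ₗᵢ[ℝ] WithLp 2 (V × ℝ)) {γ : V → ℝ} {K : ℝ≥0}
    (hγ : LipschitzWith K γ) (Φ : E → ℝ) :
    IntegrableOn Φ (range (graphPoint φ γ)) μHE[Module.finrank ℝ V] ↔
      Integrable fun x => graphDensity γ x * Φ (graphPoint φ γ x) := by
  rw [IntegrableOn, restrict_range_graphPoint φ hγ,
    (isClosedEmbedding_graphPoint φ hγ.continuous).measurableEmbedding.integrable_map_iff,
    integrable_withDensity_iff_integrable_smul₀'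
      (measurable_graphDensity γ).ennreal_ofReal.aemeasurable (by simp)]
  simp [ENNReal.toReal_ofReal (graphDensity_pos γ _).le]

theorem setIntegral_range_graphPoint (φ : E ≃ₗᵢ[ℝ] WithLp 2 (V × ℝ)) {γ : V → ℝ} {K : ℝ≥0}
    (hγ : LipschitzWith K γ) (Φ : E → ℝ) :
    ∫ y in range (graphPoint φ γ), Φ y ∂μHE[Module.finrank ℝ V] =
      ∫ x, graphDensity γ x * Φ (graphPoint φ γ x) := by
  rw [restrict_range_graphPoint φ hγ,
    (isClosedEmbedding_graphPoint φ hγ.continuous).measurableEmbedding.integral_map,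
    integral_withDensity_eq_integral_toReal_smul
      (measurable_graphDensity γ).ennreal_ofReal (by simp)]
  simp [ENNReal.toReal_ofReal (graphDensity_pos γ _).le]

end Chart
end

noncomputable section

/-! ### Boundary and outward normal in a Lipschitz chart. -/

section LipschitzDomain

set_option linter.unusedSectionVars false

open scoped NNReal ENNReal RealInnerProductSpace

variable {d : ℕ}

/-- In the open set `U`, in the coordinates `φ`, the set `Ω` is the region below the graph of the
Lipschitz function `γ`. -/
structure IsLipschitzChart (Ω U : Set (Euc d)) (φ : Euc d ≃ₗᵢ[ℝ] WithLp 2 (Euc (d - 1) × ℝ))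
    (γ : Euc (d - 1) → ℝ) (K : ℝ≥0) : Prop where
  isOpen : IsOpen U
  isBounded : Bornology.IsBounded U
  lipschitz : LipschitzWith K γ
  mem_iff : ∀ x ∈ U, x ∈ Ω ↔ x ∈ subgraph φ γ

theorem continuous_fst_chart (φ : Euc d ≃ₗᵢ[ℝ] WithLp 2 (Euc (d - 1) × ℝ)) :
    Continuous fun y => (φ y).fst :=
  continuous_fst.comp ((WithLp.prod_continuous_ofLp 2 _ ℝ).comp φ.continuous)

theorem continuous_snd_chart (φ : Euc d ≃ₗᵢ[ℝ] WithLp 2 (Euc (d - 1) × ℝ)) :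
    Continuous fun y => (φ y).snd :=
  continuous_snd.comp ((WithLp.prod_continuous_ofLp 2 _ ℝ).comp φ.continuous)

theorem isOpen_subgraph (φ : Euc d ≃ₗᵢ[ℝ] WithLp 2 (Euc (d - 1) × ℝ)) {γ : Euc (d - 1) → ℝ}
    (hγ : Continuous γ) : IsOpen (subgraph φ γ) :=
  isOpen_lt (continuous_snd_chart φ) (hγ.comp (continuous_fst_chart φ))

theorem mem_range_graphPoint (φ : Euc d ≃ₗᵢ[ℝ] WithLp 2 (Euc (d - 1) × ℝ)) {γ : Euc (d - 1) → ℝ}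
    {y : Euc d} : y ∈ range (graphPoint φ γ) ↔ (φ y).snd = γ (φ y).fst := by
  constructor
  · rintro ⟨x, rfl⟩
    simp [graphPoint]
  · intro h
    refine ⟨(φ y).fst, ?_⟩
    rw [graphPoint, LinearIsometryEquiv.symm_apply_eq]
    exact WithLp.ofLp_injective 2 (Prod.ext rfl h.symm)

theorem closure_subgraph (φ : Euc d ≃ₗᵢ[ℝ] WithLp 2 (Euc (d - 1) × ℝ)) {γ : Euc (d - 1) → ℝ}
    (hγ : Continuous γ) : closure (subgraph φ γ) = closedSubgraph φ γ := by
  apply Subset.antisymm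
  · exact closure_lt_subset_le (continuous_snd_chart φ) (hγ.comp (continuous_fst_chart φ))
  · intro y hy
    -- A point on or below the graph is a limit of points strictly below it, along the vertical.
    replace hy : (φ y).snd ≤ γ (φ y).fst := hy
    set e : Euc d := φ.symm (WithLp.toLp 2 (0, 1)) with he
    have hlim : Tendsto (fun t : ℝ => y - t • e) (𝓝[>] 0) (𝓝 y) := by
      have : Continuous fun t : ℝ => y - t • e := by fun_prop
      simpa using (this.tendsto 0).mono_left nhdsWithin_le_nhds
    refine mem_closure_of_tendsto hlim (eventually_mem_nhdsWithin.mono fun t (ht : 0 < t) => ?_)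
    change (φ (y - t • e)).snd < γ (φ (y - t • e)).fst
    simp only [map_sub, map_smul, he, LinearIsometryEquiv.apply_symm_apply, WithLp.sub_snd,
      WithLp.sub_fst, WithLp.smul_fst, WithLp.smul_snd, WithLp.toLp_fst, WithLp.toLp_snd, smul_zero, sub_zero, smul_eq_mul, mul_one]
    linarith

namespace IsLipschitzChart

variable {Ω U : Set (Euc d)} {φ : Euc d ≃ₗᵢ[ℝ] WithLp 2 (Euc (d - 1) × ℝ)}
  {γ : Euc (d - 1) → ℝ} {K : ℝ≥0}

theorem inter_eq (h : IsLipschitzChart Ω U φ γ K) : Ω ∩ U = subgraph φ γ ∩ U := by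
  ext x
  exact and_congr_left fun hx => h.mem_iff x hx

theorem mem_closure_iff (h : IsLipschitzChart Ω U φ γ K) {y : Euc d} (hy : y ∈ U) :
    y ∈ closure Ω ↔ y ∈ closedSubgraph φ γ := by
  have key : ∀ A B : Set (Euc d), A ∩ U = B ∩ U → y ∈ closure A → y ∈ closure B := by
    intro A B hAB hA
    have : y ∈ closure (A ∩ U) := IsOpen.closure_inter h.isOpen ⟨hA, hy⟩
    rw [hAB] at this
    exact closure_mono inter_subset_left this
  rw [← closure_subgraph φ h.lipschitz.continuous]
  exact ⟨key _ _ h.inter_eq, key _ _ h.inter_eq.symm⟩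

theorem mem_frontier_iff (h : IsLipschitzChart Ω U φ γ K) (hΩ : IsOpen Ω) {y : Euc d}
    (hy : y ∈ U) : y ∈ frontier Ω ↔ y ∈ range (graphPoint φ γ) := by
  rw [hΩ.frontier_eq, Set.mem_sdiff, h.mem_closure_iff hy, h.mem_iff y hy, mem_range_graphPoint]
  change (φ y).snd ≤ γ (φ y).fst ∧ ¬ (φ y).snd < γ (φ y).fst ↔ _
  rw [not_lt]
  exact ⟨fun h => le_antisymm h.1 h.2, fun h => ⟨h.le, h.ge⟩⟩

/-- At points of differentiability of `γ`, the normalized normal of its graph is the outward unit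
normal vector. -/
theorem isOutwardUnitNormal (h : IsLipschitzChart Ω U φ γ K) {x : Euc (d - 1)}
    (hx : DifferentiableAt ℝ γ x) (hU : graphPoint φ γ x ∈ U) :
    IsOutwardUnitNormal Ω (graphPoint φ γ x) ((graphDensity γ x)⁻¹ • graphNormal φ γ x) := by
  set z := graphPoint φ γ x with hz
  have hJ := graphDensity_pos γ x
  have hJ1 : 1 ≤ graphDensity γ x := Real.one_le_sqrt.mpr (by nlinarith [sq_nonneg ‖fderiv ℝ γ x‖])
  refine ⟨?_, fun ε hε => ?_⟩
  · rw [norm_smul, norm_graphNormal, norm_inv, Real.norm_eq_abs, abs_of_pos hJ,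
      inv_mul_cancel₀ hJ.ne']
  have hφz : (φ z).fst = x ∧ (φ z).snd = γ x := by simp [hz, graphPoint]
  have hlim : Tendsto (fun y => (φ y).fst) (𝓝 z) (𝓝 x) := by
    simpa [hφz.1] using (continuous_fst_chart φ).tendsto z
  filter_upwards [hlim.eventually (hx.hasFDerivAt.isLittleO.def hε), h.isOpen.mem_nhds hU]
    with y hy hyU
  rw [h.mem_iff y hyU]
  change (_ → ¬ (φ y).snd < γ (φ y).fst) ∧ (_ → (φ y).snd < γ (φ y).fst)
  have hn : ‖(φ y).fst - x‖ ≤ ‖y - z‖ := by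
    rw [← φ.norm_map (y - z), map_sub, WithLp.prod_norm_eq_of_L2]
    apply Real.le_sqrt_of_sq_le
    simp only [WithLp.sub_fst, hφz.1]
    nlinarith [sq_nonneg ‖(φ y - φ z).snd‖]
  have hin : inner ℝ (y - z) ((graphDensity γ x)⁻¹ • graphNormal φ γ x) =
      (graphDensity γ x)⁻¹ * ((φ y).snd - γ x - fderiv ℝ γ x ((φ y).fst - x)) := by
    rw [inner_smul_right, real_inner_comm, inner_graphNormal]
    simp [hφz.1, hφz.2]
  set m := (φ y).snd - γ x - fderiv ℝ γ x ((φ y).fst - x) with hm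
  have hy' : |γ (φ y).fst - γ x - fderiv ℝ γ x ((φ y).fst - x)| ≤ ε * ‖y - z‖ :=
    hy.trans (mul_le_mul_of_nonneg_left hn hε.le)
  have hy1 := abs_le.mp hy'
  have hε' : 0 ≤ ε * ‖y - z‖ := by positivity
  -- Since the density is at least 1, the cone condition pushes `m` beyond the linearization error
  -- of `γ`, with the same `ε`.
  have hJε : ε * ‖y - z‖ ≤ graphDensity γ x * (ε * ‖y - z‖) := le_mul_of_one_le_left hε' hJ1
  rw [hin]
  constructor
  · intro hlt
    rw [lt_inv_mul_iff₀ hJ] at hlt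
    linarith
  · intro hlt
    rw [inv_mul_lt_iff₀ hJ, mul_neg] at hlt
    linarith

end IsLipschitzChart

theorem IsOutwardUnitNormal.outwardNormal_eq {Ω : Set (Euc d)} {z ν : Euc d}
    (h : IsOutwardUnitNormal Ω z ν) : outwardNormal Ω z = ν := by
  have hex : ∃ ν, IsOutwardUnitNormal Ω z ν := ⟨ν, h⟩
  rw [outwardNormal, dif_pos hex]
  exact hex.choose_spec.unique h

/-- The divergence of a differentiable vector field is the trace of its derivative. -/
theorem divergence_eq_trace {F : Euc d → Euc d} {A : Euc d →L[ℝ] Euc d} {x : Euc d}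
    (h : HasFDerivAt F A x) : divergence F x = LinearMap.trace ℝ (Euc d) A := by
  rw [LinearMap.trace_eq_sum_inner _ (EuclideanSpace.basisFun (Fin d) ℝ), divergence, h.fderiv]
  refine Finset.sum_congr rfl fun i _ => ?_
  simp [EuclideanSpace.inner_single_left]

end LipschitzDomain
end

noncomputable section

/-! ### Localization by cutoffs and a partition of unity. -/

section LocalDivergence

set_option linter.unusedSectionVars false

open scoped NNReal ENNReal RealInnerProductSpace

variable {d : ℕ} {Ω U : Set (Euc d)} {φ : Euc d ≃ₗᵢ[ℝ] WithLp 2 (Euc (d - 1) × ℝ)}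
  {γ : Euc (d - 1) → ℝ} {K : ℝ≥0} {F : Euc d → Euc d} {G : Euc d → Euc d →L[ℝ] Euc d}
  {ψ : Euc d → ℝ}

/-- The derivative of `ψ • F`, where `G` is the derivative of `F`. -/
def cutoffDeriv (ψ : Euc d → ℝ) (F : Euc d → Euc d) (G : Euc d → Euc d →L[ℝ] Euc d) (x : Euc d) :
    Euc d →L[ℝ] Euc d :=
  ψ x • G x + (fderiv ℝ ψ x).smulRight (F x)

theorem hasFDerivAt_cutoff (hψ : ContDiff ℝ 1 ψ) {x : Euc d} (hF : HasFDerivAt F (G x) x) :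
    HasFDerivAt (fun y => ψ y • F y) (cutoffDeriv ψ F G x) x :=
  ((hψ.differentiable one_ne_zero) x).hasFDerivAt.smul hF

theorem cutoff_eq_zero {x : Euc d} (hx : x ∉ tsupport ψ) : ψ x • F x = 0 := by
  rw [image_eq_zero_of_notMem_tsupport hx, zero_smul]

theorem cutoffDeriv_eq_zero {x : Euc d} (hx : x ∉ tsupport ψ) : cutoffDeriv ψ F G x = 0 := by
  have h1 : fderiv ℝ ψ x = 0 := by
    have := mt (fun h => support_fderiv_subset ℝ (f := ψ) h) hx
    simpa using this
  rw [cutoffDeriv, image_eq_zero_of_notMem_tsupport hx, h1]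
  ext v; simp

namespace IsLipschitzChart

/-- The closure of `Ω` and the closed subgraph agree inside `U`, and off the support the function is
locally zero; its values where the two sets differ do not matter. -/
theorem continuousOn_closedSubgraph_of_tsupport {X : Type*} [TopologicalSpace X] [Zero X]
    (h : IsLipschitzChart Ω U φ γ K) (hψU : tsupport ψ ⊆ U) {g : Euc d → X}
    (hg : ContinuousOn g (closure Ω)) (h0 : ∀ x ∉ tsupport ψ, g x = 0) :
    ContinuousOn g (closedSubgraph φ γ) := by
  intro y hy
  by_cases hyU : y ∈ tsupport ψ
  · have hyU := hψU hyU
    have h1 := hg y ((h.mem_closure_iff hyU).mpr hy)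
    refine (h1.mono_of_mem_nhdsWithin ?_)
    filter_upwards [self_mem_nhdsWithin, mem_nhdsWithin_of_mem_nhds (h.isOpen.mem_nhds hyU)]
      with x hx hxU
    exact (h.mem_closure_iff hxU).mpr hx
  · have : g =ᶠ[𝓝 y] fun _ => 0 := by
      filter_upwards [(isClosed_tsupport ψ).isOpen_compl.mem_nhds hyU] with x hx
      exact h0 x hx
    exact (continuousAt_const.congr this.symm).continuousWithinAt

theorem isC1FieldBelowGraph (h : IsLipschitzChart Ω U φ γ K) (hψ : ContDiff ℝ 1 ψ)
    (hψU : tsupport ψ ⊆ U) (hF : ContinuousOn F (closure Ω)) (hG : ContinuousOn G (closure Ω))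
    (hFG : ∀ x ∈ Ω, HasFDerivAt F (G x) x) :
    IsC1FieldBelowGraph φ γ (fun y => ψ y • F y) (cutoffDeriv ψ F G) (tsupport ψ) where
  continuousOn := h.continuousOn_closedSubgraph_of_tsupport hψU
    (hψ.continuous.continuousOn.smul hF) fun _ => cutoff_eq_zero
  continuousOn_deriv := h.continuousOn_closedSubgraph_of_tsupport hψU
    ((hψ.continuous.continuousOn.smul hG).add
      ((ContinuousLinearMap.smulRightL ℝ (Euc d) (Euc d)).continuous₂.comp_continuousOn
        ((hψ.continuous_fderiv one_ne_zero).continuousOn.prodMk hF)))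
    fun _ => cutoffDeriv_eq_zero
  hasFDerivAt y hy := by
    by_cases hyU : y ∈ tsupport ψ
    · exact hasFDerivAt_cutoff hψ (hFG y ((h.mem_iff y (hψU hyU)).mpr hy))
    · rw [cutoffDeriv_eq_zero hyU]
      have : (fun y => ψ y • F y) =ᶠ[𝓝 y] fun _ => 0 := by
        filter_upwards [(isClosed_tsupport ψ).isOpen_compl.mem_nhds hyU] with x hx
        exact cutoff_eq_zero hx
      exact (hasFDerivAt_const (0 : Euc d) y).congr_of_eventuallyEq this
  isCompact := Metric.isCompact_of_isClosed_isBounded (isClosed_tsupport ψ)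
    (h.isBounded.subset hψU)
  eq_zero _ := cutoff_eq_zero
  deriv_eq_zero _ := cutoffDeriv_eq_zero

/-- This replaces `Ω` by the subgraph and `frontier Ω` by the whole graph under the integrals. -/
theorem indicator_eq_of_tsupport {A B : Set (Euc d)} (hAB : ∀ x ∈ U, x ∈ A ↔ x ∈ B)
    (hψU : tsupport ψ ⊆ U) {g : Euc d → ℝ} (h0 : ∀ x ∉ tsupport ψ, g x = 0) :
    A.indicator g = B.indicator g := by
  ext x
  by_cases hx : x ∈ tsupport ψ
  · classical
    simp only [indicator_apply, hAB x (hψU hx)]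
  · simp only [indicator, h0 x hx, ite_self]

/-- Weighted by the area density, the outward unit normal of `Ω` is the normal of the graph. -/
theorem graphDensity_mul_inner_ae (h : IsLipschitzChart Ω U φ γ K) (hψU : tsupport ψ ⊆ U) :
    (fun x => graphDensity γ x * ⟪ψ (graphPoint φ γ x) • F (graphPoint φ γ x),
        outwardNormal Ω (graphPoint φ γ x)⟫) =ᵐ[volume]
      fun x => ⟪ψ (graphPoint φ γ x) • F (graphPoint φ γ x), graphNormal φ γ x⟫ := by
  -- By Rademacher's theorem, points where `outwardNormal` may take its default value 0 are
  -- negligible.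
  filter_upwards [h.lipschitz.ae_differentiableAt] with x hx
  by_cases hxU : graphPoint φ γ x ∈ tsupport ψ
  · rw [(h.isOutwardUnitNormal hx (hψU hxU)).outwardNormal_eq, inner_smul_right, ← mul_assoc,
      mul_inv_cancel₀ (graphDensity_pos γ x).ne', one_mul]
  · simp [image_eq_zero_of_notMem_tsupport hxU]

/-- The divergence theorem for a field supported in the domain of a chart. -/
theorem divergence_theorem (h : IsLipschitzChart Ω U φ γ K) (hΩ : IsOpen Ω)
    (hψ : ContDiff ℝ 1 ψ) (hψU : tsupport ψ ⊆ U) (hF : ContinuousOn F (closure Ω))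
    (hG : ContinuousOn G (closure Ω)) (hFG : ∀ x ∈ Ω, HasFDerivAt F (G x) x) :
    IntegrableOn (fun y => LinearMap.trace ℝ (Euc d) (cutoffDeriv ψ F G y)) Ω ∧
    Integrable (fun y => ⟪ψ y • F y, outwardNormal Ω y⟫) (surfaceMeasure Ω) ∧
    ∫ y in Ω, LinearMap.trace ℝ (Euc d) (cutoffDeriv ψ F G y) =
      ∫ y, ⟪ψ y • F y, outwardNormal Ω y⟫ ∂(surfaceMeasure Ω) := by
  have hC := h.isC1FieldBelowGraph hψ hψU hF hG hFG
  have hSm : MeasurableSet (subgraph φ γ) :=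
    (isOpen_subgraph φ h.lipschitz.continuous).measurableSet
  have hRm : MeasurableSet (range (graphPoint φ γ)) :=
    (isClosedEmbedding_graphPoint φ h.lipschitz.continuous).isClosed_range.measurableSet
  have hfm : MeasurableSet (frontier Ω) := isClosed_frontier.measurableSet
  have hI1 : Ω.indicator (fun y => LinearMap.trace ℝ (Euc d) (cutoffDeriv ψ F G y)) =
      (subgraph φ γ).indicator fun y => LinearMap.trace ℝ (Euc d) (cutoffDeriv ψ F G y) :=
    indicator_eq_of_tsupport h.mem_iff hψU fun x hx => by simp [cutoffDeriv_eq_zero hx]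
  have hI2 : (frontier Ω).indicator (fun y => ⟪ψ y • F y, outwardNormal Ω y⟫) =
      (range (graphPoint φ γ)).indicator fun y => ⟪ψ y • F y, outwardNormal Ω y⟫ :=
    indicator_eq_of_tsupport (fun x hx => h.mem_frontier_iff hΩ hx) hψU fun x hx => by
      simp [cutoff_eq_zero hx]
  have hk : (μHE[d - 1] : Measure (Euc d)) = μHE[Module.finrank ℝ (Euc (d - 1))] := by
    rw [finrank_euclideanSpace_fin]
  have hae := h.graphDensity_mul_inner_ae (F := F) hψU
  refine ⟨?_, ?_, ?_⟩
  · rw [← integrable_indicator_iff hΩ.measurableSet, hI1, integrable_indicator_iff hSm]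
    exact hC.integrableOn_trace h.lipschitz
  · change IntegrableOn _ (frontier Ω) _
    rw [← integrable_indicator_iff hfm, hI2, integrable_indicator_iff hRm, hk,
      integrableOn_range_graphPoint_iff φ h.lipschitz, integrable_congr hae]
    exact hC.integrable_inner_graphNormal h.lipschitz
  · rw [surfaceMeasure, ← integral_indicator hΩ.measurableSet, hI1, integral_indicator hSm,
      ← integral_indicator hfm, hI2, integral_indicator hRm, hk,
      setIntegral_range_graphPoint φ h.lipschitz, integral_congr_ae hae]
    exact hC.setIntegral_trace h.lipschitz

end IsLipschitzChart

/-- Every boundary or interior point has a neighbourhood in which `Ω` is the region below a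
Lipschitz graph. -/
def HasLipschitzCharts (Ω : Set (Euc d)) : Prop :=
  ∀ z ∈ closure Ω, ∃ U φ γ K, z ∈ U ∧ IsLipschitzChart Ω U φ γ K

/-- The divergence theorem on bounded open sets that are locally below Lipschitz graphs. -/
theorem divergence_theorem_of_hasLipschitzCharts (hΩ : IsOpen Ω) (hb : Bornology.IsBounded Ω)
    (hch : HasLipschitzCharts Ω) (hF : IsC1OnClosure Ω F) :
    IntegrableOn (divergence F) Ω ∧
    Integrable (fun x => ⟪F x, outwardNormal Ω x⟫) (surfaceMeasure Ω) ∧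
    ∫ x in Ω, divergence F x = ∫ x, ⟪F x, outwardNormal Ω x⟫ ∂(surfaceMeasure Ω) := by
  obtain ⟨hFc, G, hGc, hFG⟩ := hF
  choose! U φ γ K hzU hU using hch
  have hcomp : IsCompact (closure Ω) := hb.isCompact_closure
  obtain ⟨t, htΩ, ht⟩ := hcomp.elim_nhds_subcover U fun z hz => (hU z hz).isOpen.mem_nhds (hzU z hz)
  obtain ⟨f, hf⟩ := SmoothPartitionOfUnity.exists_isSubordinate (modelWithCornersSelf ℝ (Euc d))
    (isClosed_closure (s := Ω)) (fun i : t => U i) (fun i => (hU i (htΩ i i.2)).isOpen)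
    (by simpa [iUnion_subtype] using ht)
  have hdiff : ∀ i, ContDiff ℝ 1 (f i) := fun i =>
    ((f i).contMDiff.contDiff).of_le (by simp)
  have hsum : ∀ x ∈ closure Ω, ∑ i, f i x = 1 := fun x hx => by
    rw [← finsum_eq_sum_of_fintype]; exact f.sum_eq_one hx
  have key := fun i : t =>
    (hU i (htΩ i i.2)).divergence_theorem hΩ (hdiff i) (hf i) hFc hGc hFG
  have hdiv : ∀ x ∈ Ω, divergence F x =
      ∑ i, LinearMap.trace ℝ (Euc d) (cutoffDeriv (f i) F G x) := by
    intro x hx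
    have h1 : HasFDerivAt (fun y => ∑ i, f i y • F y) (∑ i, cutoffDeriv (f i) F G x) x :=
      HasFDerivAt.fun_sum fun i _ => hasFDerivAt_cutoff (hdiff i) (hFG x hx)
    -- The equality holds near `x`, not only at `x`, so the terms with derivatives of the `f i`
    -- cancel in the sum.
    have h2 : F =ᶠ[𝓝 x] fun y => ∑ i, f i y • F y := by
      filter_upwards [hΩ.mem_nhds hx] with y hy
      rw [← Finset.sum_smul, hsum y (subset_closure hy), one_smul]
    rw [divergence_eq_trace (h1.congr_of_eventuallyEq h2)]
    simp
  have hinn : ∀ x ∈ frontier Ω, ⟪F x, outwardNormal Ω x⟫ =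
      ∑ i, ⟪f i x • F x, outwardNormal Ω x⟫ := by
    intro x hx
    rw [← sum_inner, ← Finset.sum_smul, hsum x (frontier_subset_closure hx), one_smul]
  have hinn' : (fun x => ⟪F x, outwardNormal Ω x⟫) =ᵐ[surfaceMeasure Ω]
      fun x => ∑ i, ⟪f i x • F x, outwardNormal Ω x⟫ :=
    (ae_restrict_mem isClosed_frontier.measurableSet).mono hinn
  refine ⟨?_, ?_, ?_⟩
  · exact (integrableOn_congr_fun hdiv hΩ.measurableSet).mpr
      (integrable_finsetSum _ fun i _ => (key i).1)
  · exact (integrable_congr hinn').mpr (integrable_finsetSum _ fun i _ => (key i).2.1)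
  · rw [setIntegral_congr_fun hΩ.measurableSet hdiv, integral_congr_ae hinn',
      integral_finsetSum _ fun i _ => (key i).1, integral_finsetSum _ fun i _ => (key i).2.1]
    exact Finset.sum_congr rfl fun i _ => (key i).2.2

end LocalDivergence
end

noncomputable section

/-! ### Lipschitz charts for both kinds of boundary. -/

section MainTheorem

open scoped NNReal

variable {d : ℕ} {Ω : Set (Euc d)}

/-- A function Lipschitz on `s` extends to a globally Lipschitz one; the chart is shrunk to lie over
`s`, where the two agree. The agreement is kept in the conclusion to carry over differentiability.
-/
theorem exists_isLipschitzChart_of_lipschitzOnWith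
    {z : Euc d} {U : Set (Euc d)} (hU : U ∈ 𝓝 z) {φ : Euc d ≃ₗᵢ[ℝ] WithLp 2 (Euc (d - 1) × ℝ)}
    {γ : Euc (d - 1) → ℝ} (hiff : ∀ x ∈ U, x ∈ Ω ↔ (φ x).snd < γ (φ x).fst) {K : ℝ≥0}
    {s : Set (Euc (d - 1))} (hs : s ∈ 𝓝 (φ z).fst) (hγ : LipschitzOnWith K γ s) :
    ∃ U' γ', z ∈ U' ∧ IsLipschitzChart Ω U' φ γ' K ∧ EqOn γ γ' s := by
  obtain ⟨γ', hγ', heq⟩ := hγ.extend_real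
  refine ⟨interior U ∩ (Metric.ball z 1 ∩ (fun y => (φ y).fst) ⁻¹' interior s), γ',
    ⟨mem_interior_iff_mem_nhds.mpr hU, Metric.mem_ball_self one_pos,
      mem_interior_iff_mem_nhds.mpr hs⟩, ⟨?_, ?_, hγ', ?_⟩, heq⟩
  · exact isOpen_interior.inter (Metric.isOpen_ball.inter
      (isOpen_interior.preimage (continuous_fst_chart φ)))
  · exact Metric.isBounded_ball.subset (inter_subset_right.trans inter_subset_left)
  · rintro x ⟨hxU, -, hxs⟩
    rw [hiff x (interior_subset hxU), heq (interior_subset hxs)]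
    rfl

theorem HasGraphBoundary.mono {P Q : (Euc (d - 1) → ℝ) → Prop} (h : HasGraphBoundary P Ω)
    (hPQ : ∀ γ, P γ → Q γ) : HasGraphBoundary Q Ω := fun z hz =>
  let ⟨U, hU, φ, γ, hγ, hiff⟩ := h z hz
  ⟨U, hU, φ, γ, hPQ γ hγ, hiff⟩

/-- Near an interior point a horizontal hyperplane at height one above it serves as graph: all
nearby points lie both in `Ω` and below it. Charts at interior points spare a separate argument for
fields supported inside `Ω`. The bound `1 ≤ d` gives `(d - 1) + 1 = d`. -/
theorem exists_isLipschitzChart_of_isOpen (hd : 1 ≤ d) (hΩ : IsOpen Ω) {z : Euc d} (hz : z ∈ Ω) :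
    ∃ U φ γ K, z ∈ U ∧ IsLipschitzChart Ω U φ γ K := by
  have hrank : Module.finrank ℝ (Euc d) = Module.finrank ℝ (WithLp 2 (Euc (d - 1) × ℝ)) := by
    rw [(WithLp.linearEquiv 2 ℝ (Euc (d - 1) × ℝ)).finrank_eq, Module.finrank_prod,
      finrank_euclideanSpace_fin, finrank_euclideanSpace_fin, Module.finrank_self]
    omega
  let φ : Euc d ≃ₗᵢ[ℝ] WithLp 2 (Euc (d - 1) × ℝ) := 
    (stdOrthonormalBasis ℝ (Euc d)).equiv (stdOrthonormalBasis ℝ _) (finCongr hrank)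
  have hU : Ω ∩ {x | (φ x).snd < (φ z).snd + 1} ∈ 𝓝 z :=
    inter_mem (hΩ.mem_nhds hz)
      ((isOpen_lt (continuous_snd_chart φ) continuous_const).mem_nhds (by simp))
  obtain ⟨U', γ', hzU, hU', -⟩ := exists_isLipschitzChart_of_lipschitzOnWith hU
    (γ := fun _ => (φ z).snd + 1) (fun x hx => ⟨fun _ => hx.2, fun _ => hx.1⟩) univ_mem
    (LipschitzWith.const _).lipschitzOnWith
  exact ⟨U', φ, γ', 0, hzU, hU'⟩

/-- Local Lipschitz continuity of the graph function is the common weakening of the `C¹` and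
Lipschitz conditions. -/
theorem hasLipschitzCharts_of_hasGraphBoundary (hd : 1 ≤ d) (hΩ : IsOpen Ω)
    (h : HasGraphBoundary (fun γ => ∀ x, ∃ K, ∃ s ∈ 𝓝 x, LipschitzOnWith K γ s) Ω) :
    HasLipschitzCharts Ω := by
  intro z hz
  by_cases hzΩ : z ∈ Ω
  · exact exists_isLipschitzChart_of_isOpen hd hΩ hzΩ
  · obtain ⟨U, hU, φ, γ, hγ, hiff⟩ := h z (by rw [hΩ.frontier_eq]; exact ⟨hz, hzΩ⟩)
    obtain ⟨K, s, hs, hK⟩ := hγ (φ z).fst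
    obtain ⟨U', γ', hzU, hU', -⟩ := exists_isLipschitzChart_of_lipschitzOnWith hU hiff hs hK
    exact ⟨U', φ, γ', K, hzU, hU'⟩

/-- On a `C¹` boundary the outward unit normal vector exists everywhere. -/
theorem HasC1Boundary.isOutwardUnitNormal (h : HasC1Boundary Ω) (hΩ : IsOpen Ω) {z : Euc d}
    (hz : z ∈ frontier Ω) : IsOutwardUnitNormal Ω z (outwardNormal Ω z) := by
  obtain ⟨U, hU, φ, γ, hγ, hiff⟩ := h z hz
  obtain ⟨K, s, hs, hK⟩ := hγ.contDiffAt.exists_lipschitzOnWith (x := (φ z).fst)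
  obtain ⟨U', γ', hzU, hU', heq⟩ := exists_isLipschitzChart_of_lipschitzOnWith hU hiff hs hK
  obtain ⟨x, rfl⟩ := (hU'.mem_frontier_iff hΩ hzU).mp hz
  have hx : (φ (graphPoint φ γ' x)).fst = x := by simp [graphPoint]
  rw [hx] at hs
  -- The extension `γ'` is only Lipschitz globally, but it equals the `C¹` function `γ` near `x`.
  have hdiff : DifferentiableAt ℝ γ' x :=
    ((hγ.differentiable one_ne_zero) x).congr_of_eventuallyEq
      (heq.symm.eventuallyEq_of_mem hs)
  have hn := hU'.isOutwardUnitNormal hdiff hzU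
  rwa [hn.outwardNormal_eq]

end MainTheorem
end

theorem mainTheorem1 {d : ℕ} (hd : 1 ≤ d) (Ω : Set (Euc d)) (hΩ : IsBoundedDomain Ω) :
    (HasC1Boundary Ω → ∀ z ∈ frontier Ω, IsOutwardUnitNormal Ω z (outwardNormal Ω z)) ∧
    (HasC1Boundary Ω ∨ HasAccessiblePiecewiseC1Boundary Ω →
      ∀ F : Euc d → Euc d, IsC1OnClosure Ω F →
        IntegrableOn (divergence F) Ω ∧
        Integrable (fun x => inner ℝ (F x) (outwardNormal Ω x)) (surfaceMeasure Ω) ∧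
        ∫ x in Ω, divergence F x =
          ∫ x, inner ℝ (F x) (outwardNormal Ω x) ∂(surfaceMeasure Ω)) := by
  refine ⟨fun h z hz => h.isOutwardUnitNormal hΩ.isOpen hz, fun h F hF => ?_⟩
  refine divergence_theorem_of_hasLipschitzCharts hΩ.isOpen hΩ.isBounded
    (hasLipschitzCharts_of_hasGraphBoundary hd hΩ.isOpen ?_) hF
  rcases h with h | ⟨N, G, B, h, -⟩
  · exact HasGraphBoundary.mono h fun γ hγ x => hγ.contDiffAt.exists_lipschitzOnWith
  · exact HasGraphBoundary.mono h.lipschitz fun γ ⟨K, hK⟩ x =>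
      ⟨K, univ, univ_mem, hK.lipschitzOnWith⟩
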